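/- Let $R$ be a (left) Noetherian ring with unit, not necessarily commutative. All chain complexes are complexes of (left) $R$-modules in degrees $\ge 0$ augmented over $R$, and all chain maps preserve the augmentation. For a topological space $X$, $S(X,R)$ is the singular chain complex, augmented by sending every point to $1$. The support $\|c\|$ of a singular chain $c$ is the smallest subset $A\subset X$ with $c\in S(A,R)$; for a singular simplex $\sigma$, $\|\sigma\|$ denotes its image. For a family $\mathcal V$ of subsets of $X$, $S(X,\mathcal V,R)\subset S(X,R)$ is the subcomplex generated by the singular simplices whose image lies in a member of $\mathcal V$. Faces of a (singular) simplex are faces of any dimension, the simplex itself included. For a simplicial complex $N$, $C(N,R)$ is the complex of oriented simplicial chains. Let $\mathcal U$ be an open cover of a space $Y$. A *partial algebraic realization of $N$ in $Y$ relative to $\mathcal U$* is a subcomplex $M$ of $N$ containing all vertices of $N$ together with a chain map $\mu:C(M,R)\to S(Y,R)$ such that for every simplex $s$ of $N$ some member of $\mathcal U$ contains $\|\mu(t)\|$ for all faces $t$ of $s$ belonging to $M$; it is *complete* if $M=N$. A metrizable space $Y$ is an *$R$-algebraic absolute neighbourhood retract* ($R$-algebraic ANR) if every open cover $\mathcal U$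 of $Y$ has an open refinement $\mathcal V$ covering $Y$ such that, for every simplicial complex $N$, every partial algebraic realization of $N$ in $Y$ relative to $\mathcal V$ extends to a complete algebraic realization of $N$ relative to $\mathcal U$. **Lemma.** Let $X_1,\dots,X_n$ be closed subsets of a metrizable space $X$ with $X=X_1\cup\dots\cup X_n$, such that for every nonempty $u\subset\{1,\dots,n\}$ for which $X_u=\bigcap_{i\in u}X_i$ is nonempty, $X_u$ is an $R$-algebraic ANR. Then for every open cover $\mathcal U$ of $X$ there are an open cover $\mathcal V$ of $X$ and a chain map $\varphi:S(X,\mathcal V,R)\to S(X,R)$ such that (i) for every singular simplex $\sigma$ of $S(X,\mathcal V,R)$ there is $U\in\mathcal U$ containing $\|\sigma\|$ and $\|\varphi(\tau)\|$ for every face $\tau$ of $\sigma$; (ii) every compact $D\subset X$ has a neighbourhood $E$ in $X$ such that the graded module $\varphi(S(E,R)\cap S(X,\mathcal V,R))$ is finitely generated (by finitely many elements in all degrees together). -/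

import Mathlib

universe u v w

open Topology

/-- A positive chain complex of left `R`-modules, augmented over `R`. -/
structure AugComplex (R : Type v) [Ring R] where
  obj : ℕ → Type w
  [addCommGroup : ∀ p, AddCommGroup (obj p)]
  [module : ∀ p, Module R (obj p)]
  d : ∀ p, obj (p + 1) →ₗ[R] obj p
  aug : obj 0 →ₗ[R] R
  d_d : ∀ p (c : obj (p + 2)), d p (d (p + 1) c) = 0
  aug_d : ∀ c : obj 1, aug (d 0 c) = 0

attribute [instance] AugComplex.addCommGroup AugComplex.module

namespace AugComplex

variable {R : Type v} [Ring R]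

/-- A chain map preserving the augmentation. -/
structure Hom (C D : AugComplex.{v, w} R) where
  f : ∀ p, C.obj p →ₗ[R] D.obj p
  f_d : ∀ p (c : C.obj (p + 1)), f p (C.d p c) = D.d p (f (p + 1) c)
  aug_f : ∀ c : C.obj 0, D.aug (f 0 c) = C.aug c

/-- The subcomplex of `C` given by submodules stable under the boundary. -/
def sub (C : AugComplex.{v, w} R) (P : ∀ p, Submodule R (C.obj p))
    (hP : ∀ p, ∀ c ∈ P (p + 1), C.d p c ∈ P p) : AugComplex.{v, w} R where
  obj p := P p
  d p := (C.d p).restrict (hP p)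
  aug := C.aug ∘ₗ (P 0).subtype
  d_d p c := Subtype.ext (C.d_d p c)
  aug_d c := C.aug_d c

end AugComplex

section Singular

/-- The singular `p`-simplices of `X`. -/
abbrev SingularSimplex (X : Type u) [TopologicalSpace X] (p : ℕ) : Type u :=
  C(stdSimplex ℝ (Fin (p + 1)), X)

/-- The affine map of standard simplices induced by a map of vertices. -/
noncomputable def simplexMap {q p : ℕ} (f : Fin (q + 1) → Fin (p + 1)) :
    C(stdSimplex ℝ (Fin (q + 1)), stdSimplex ℝ (Fin (p + 1))) :=
  ⟨stdSimplex.map f, stdSimplex.continuous_map f⟩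

theorem simplexMap_comp {r q p : ℕ} (f : Fin (q + 1) → Fin (p + 1))
    (g : Fin (r + 1) → Fin (q + 1)) :
    (simplexMap f).comp (simplexMap g) = simplexMap (f ∘ g) :=
  ContinuousMap.ext fun x => stdSimplex.map_comp_apply g f x

variable {X : Type u} [TopologicalSpace X]

/-- `τ` is a face (of any codimension, possibly `σ` itself) of the singular simplex `σ`. -/
def IsFace {q p : ℕ} (τ : SingularSimplex X q) (σ : SingularSimplex X p) : Prop :=
  ∃ f : Fin (q + 1) ↪o Fin (p + 1), τ = σ.comp (simplexMap f)

variable (R : Type v) [Ring R]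

/-- The boundary `∂σ = ∑ᵢ (-1)ⁱ σ ∘ δᵢ`. -/
noncomputable def singularBoundary (p : ℕ) :
    (SingularSimplex X (p + 1) →₀ R) →ₗ[R] (SingularSimplex X p →₀ R) :=
  Finsupp.linearCombination R fun σ : SingularSimplex X (p + 1) =>
    ∑ i : Fin (p + 2), (-1 : ℤ) ^ (i : ℕ) •
      Finsupp.single (σ.comp (simplexMap i.succAbove)) (1 : R)

theorem singularBoundary_single (p : ℕ) (σ : SingularSimplex X (p + 1)) :
    singularBoundary R p (Finsupp.single σ 1) =
      ∑ i : Fin (p + 2), (-1 : ℤ) ^ (i : ℕ) •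
        Finsupp.single (σ.comp (simplexMap i.succAbove)) (1 : R) := by
  simp [singularBoundary]

theorem singularBoundary_singularBoundary (p : ℕ) (c : SingularSimplex X (p + 2) →₀ R) :
    singularBoundary R p (singularBoundary R (p + 1) c) = 0 := by
  suffices h : singularBoundary R p ∘ₗ singularBoundary R (p + 1) =
      (0 : (SingularSimplex X (p + 2) →₀ R) →ₗ[R] (SingularSimplex X p →₀ R)) from
    LinearMap.congr_fun h c
  refine Finsupp.lhom_ext' fun σ => LinearMap.ext_ring ?_
  simp only [LinearMap.comp_apply, Finsupp.lsingle_apply, LinearMap.zero_apply,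
    singularBoundary_single, map_sum, map_zsmul, Finset.smul_sum, smul_smul,
    ContinuousMap.comp_assoc, simplexMap_comp]
  rw [Finset.sum_comm, ← Finset.sum_product']
  let P := Fin (p + 2) × Fin (p + 3)
  let S : Finset P := {ij : P | (ij.2 : ℕ) ≤ (ij.1 : ℕ)}
  rw [Finset.univ_product_univ, ← Finset.sum_add_sum_compl S, ← eq_neg_iff_add_eq_zero,
    ← Finset.sum_neg_distrib]
  let φ : ∀ ij : P, ij ∈ S → P := fun ij hij =>
    (Fin.castLT ij.2 (lt_of_le_of_lt (Finset.mem_filter.mp hij).right (Fin.is_lt ij.1)),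
      ij.1.succ)
  apply Finset.sum_bij φ
  · intro ij hij
    simp_rw [S, φ, Finset.compl_filter, Finset.mem_filter_univ, Fin.val_succ,
      Fin.val_castLT] at hij ⊢
    lia
  · rintro ⟨i, j⟩ hij ⟨i', j'⟩ hij' h
    have h1 := congrArg (fun a : P => (a.1 : ℕ)) h
    have h2 := congrArg (fun a : P => (a.2 : ℕ)) h
    simp only [φ, Fin.val_castLT, Fin.val_succ] at h1 h2
    exact Prod.ext (Fin.ext (by lia)) (Fin.ext h1)
  · rintro ⟨i', j'⟩ hij'
    simp_rw [S, Finset.compl_filter, Finset.mem_filter_univ, not_le] at hij'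
    refine ⟨(j'.pred ?_, Fin.castSucc i'), ?_, ?_⟩
    · rintro rfl
      simp at hij'
    · simp only [S, Finset.mem_filter_univ, Fin.val_castSucc, Fin.val_pred]
      lia
    · simp only [φ, Fin.castLT_castSucc, Fin.succ_pred]
  · rintro ⟨i, j⟩ hij
    simp only [S, Finset.mem_filter_univ] at hij
    rw [← neg_smul]
    congr 1
    · simp only [φ, Fin.val_succ, Fin.val_castLT, pow_add, pow_one]
      ring
    · congr 3
      funext k
      simp only [φ, Function.comp_apply, Fin.ext_iff, Fin.succAbove, Fin.lt_def]
      split_ifs <;> simp_all <;> lia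

/-- The singular chain complex `S(X, R)`. -/
noncomputable def singularComplex (X : Type u) [TopologicalSpace X] :
    AugComplex.{v, max u v} R where
  obj p := SingularSimplex X p →₀ R
  d p := singularBoundary R p
  aug := Finsupp.linearCombination R fun _ => (1 : R)
  d_d p c := singularBoundary_singularBoundary R p c
  aug_d c := by
    induction c using Finsupp.induction_linear with
    | zero => simp
    | add a b ha hb => rw [map_add, map_add, ha, hb, add_zero]
    | single σ r =>
      have : Finsupp.single σ r = r • Finsupp.single σ (1 : R) := by simp
      rw [this, map_smul, map_smul, singularBoundary_single]
      simp [Fin.sum_univ_two]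

variable {R}

/-- The support `‖c‖` of a singular chain. -/
def chainSupport {p : ℕ} (c : SingularSimplex X p →₀ R) : Set X :=
  ⋃ σ ∈ c.support, Set.range σ

variable (R)

/-- `S_p(A, R)`, as a submodule of `S_p(X, R)`. -/
noncomputable def chainsIn (A : Set X) (p : ℕ) : Submodule R (SingularSimplex X p →₀ R) :=
  Finsupp.supported R R {σ | Set.range σ ⊆ A}

/-- `‖c‖` is the smallest subset `A` of `X` with `c ∈ S(A, R)`. -/
theorem mem_chainsIn_iff {A : Set X} {p : ℕ} {c : SingularSimplex X p →₀ R} :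
    c ∈ chainsIn R A p ↔ chainSupport c ⊆ A := by
  simp only [chainsIn, Finsupp.mem_supported, chainSupport, Set.iUnion_subset_iff]
  rfl

/-- `S_p(X, 𝒱, R)`: the submodule of `S_p(X, R)` generated by the singular simplices whose image
lies in a member of `𝒱`. -/
noncomputable def smallChains (𝒱 : Set (Set X)) (p : ℕ) :
    Submodule R (SingularSimplex X p →₀ R) :=
  Finsupp.supported R R {σ | ∃ V ∈ 𝒱, Set.range σ ⊆ V}

theorem single_mem_smallChains {𝒱 : Set (Set X)} {p : ℕ} {σ : SingularSimplex X p}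
    (hσ : ∃ V ∈ 𝒱, Set.range σ ⊆ V) : Finsupp.single σ (1 : R) ∈ smallChains R 𝒱 p :=
  Finsupp.single_mem_supported R 1 hσ

theorem range_comp_subset {q p : ℕ} (σ : SingularSimplex X p)
    (g : C(stdSimplex ℝ (Fin (q + 1)), stdSimplex ℝ (Fin (p + 1)))) :
    Set.range (σ.comp g) ⊆ Set.range σ := by
  rintro _ ⟨x, rfl⟩
  exact ⟨g x, rfl⟩

theorem IsFace.small {𝒱 : Set (Set X)} {q p : ℕ} {τ : SingularSimplex X q}
    {σ : SingularSimplex X p} (h : IsFace τ σ) (hσ : ∃ V ∈ 𝒱, Set.range σ ⊆ V) :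
    ∃ V ∈ 𝒱, Set.range τ ⊆ V := by
  obtain ⟨f, rfl⟩ := h
  obtain ⟨V, hV, hσV⟩ := hσ
  exact ⟨V, hV, (range_comp_subset σ _).trans hσV⟩

theorem singularBoundary_mem_smallChains (𝒱 : Set (Set X)) (p : ℕ)
    (c : SingularSimplex X (p + 1) →₀ R) (hc : c ∈ smallChains R 𝒱 (p + 1)) :
    singularBoundary R p c ∈ smallChains R 𝒱 p := by
  rw [singularBoundary, Finsupp.linearCombination_apply]
  refine Submodule.sum_mem _ fun σ hσ => Submodule.smul_mem _ _ <|
    Submodule.sum_mem _ fun i _ => zsmul_mem (single_mem_smallChains R ?_) _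
  obtain ⟨V, hV, hσV⟩ := hc hσ
  exact ⟨V, hV, (range_comp_subset σ _).trans hσV⟩

/-- The subcomplex `S(X, 𝒱, R)` of `S(X, R)`. -/
noncomputable def smallComplex (𝒱 : Set (Set X)) : AugComplex.{v, max u v} R :=
  (singularComplex R X).sub (fun p => smallChains R 𝒱 p)
    fun p c hc => singularBoundary_mem_smallChains R 𝒱 p c hc

end Singular

section Oriented

variable {ι : Type u}

/-- The `q`-simplices of a simplicial complex. -/
abbrev QSimplex (N : PreAbstractSimplicialComplex ι) (q : ℕ) : Type u :=
  {s : Finset ι // s ∈ N.faces ∧ s.card = q + 1}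

variable [LinearOrder ι]

/-- The face of a `(q + 1)`-simplex opposite to one of its vertices. -/
def QSimplex.erase {N : PreAbstractSimplicialComplex ι} {q : ℕ} (s : QSimplex N (q + 1))
    (x : s.1) : QSimplex N q :=
  have h : (s.1.erase x).card = q + 1 := by
    rw [Finset.card_erase_of_mem x.2, s.2.2, Nat.add_sub_cancel]
  ⟨s.1.erase x, (N.isRelLowerSet_faces s.2.1).2 (Finset.erase_subset _ _)
    (Finset.card_pos.mp (by omega)), h⟩

/-- The sign `(-1)ⁱ`, where `i` is the position of `x` in `s` for the order of the vertices. -/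
def vertexSign (s : Finset ι) (x : ι) : ℤ :=
  (-1) ^ (s.filter (· < x)).card

theorem vertexSign_erase_neg {s : Finset ι} {x y : ι} (hx : x ∈ s) (hy : y ∈ s) (hxy : x ≠ y) :
    vertexSign s x * vertexSign (s.erase x) y = -(vertexSign s y * vertexSign (s.erase y) x) := by
  wlog h : x < y generalizing x y
  · rw [this hy hx hxy.symm (lt_of_le_of_ne (not_lt.mp h) hxy.symm), neg_neg]
  have h1 : (s.erase y).filter (· < x) = s.filter (· < x) := by
    ext z
    simp only [Finset.mem_filter, Finset.mem_erase]
    exact ⟨fun hz => ⟨hz.1.2, hz.2⟩, fun hz => ⟨⟨(hz.2.trans h).ne, hz.1⟩, hz.2⟩⟩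
  have h2 : ((s.erase x).filter (· < y)).card + 1 = (s.filter (· < y)).card := by
    rw [Finset.filter_erase]
    exact Finset.card_erase_add_one (Finset.mem_filter.mpr ⟨hx, h⟩)
  rw [vertexSign, vertexSign, vertexSign, vertexSign, h1, ← h2, pow_succ]
  ring

variable (R : Type v) [Ring R]

/-- The boundary of oriented chains: `∂⟨x₀, …, x_q⟩ = ∑ᵢ (-1)ⁱ ⟨x₀, …, x̂ᵢ, …, x_q⟩` for
`x₀ < ⋯ < x_q`. -/
noncomputable def orientedBoundary (N : PreAbstractSimplicialComplex ι) (q : ℕ) :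
    (QSimplex N (q + 1) →₀ R) →ₗ[R] (QSimplex N q →₀ R) :=
  Finsupp.linearCombination R fun s : QSimplex N (q + 1) =>
    ∑ x : s.1, vertexSign s.1 x • Finsupp.single (s.erase x) (1 : R)

theorem orientedBoundary_single (N : PreAbstractSimplicialComplex ι) (q : ℕ)
    (s : QSimplex N (q + 1)) :
    orientedBoundary R N q (Finsupp.single s 1) =
      ∑ x : s.1, vertexSign s.1 x • Finsupp.single (s.erase x) (1 : R) := by
  simp [orientedBoundary]

theorem orientedBoundary_orientedBoundary (N : PreAbstractSimplicialComplex ι) (q : ℕ)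
    (c : QSimplex N (q + 2) →₀ R) :
    orientedBoundary R N q (orientedBoundary R N (q + 1) c) = 0 := by
  suffices h : orientedBoundary R N q ∘ₗ orientedBoundary R N (q + 1) = 0 from
    LinearMap.congr_fun h c
  refine Finsupp.lhom_ext' fun s => LinearMap.ext_ring ?_
  simp only [LinearMap.comp_apply, Finsupp.lsingle_apply, LinearMap.zero_apply,
    orientedBoundary_single, map_sum, map_zsmul, Finset.smul_sum, smul_smul]
  rw [Finset.sum_sigma']
  have hmem (a : (x : s.1) × (s.erase x).1) : a.2.1 ∈ s.1 ∧ a.2.1 ≠ a.1.1 := by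
    have := a.2.2
    simp only [QSimplex.erase, Finset.mem_erase] at this
    exact ⟨this.2, this.1⟩
  refine Finset.sum_involution
    (fun a _ => ⟨⟨a.2.1, (hmem a).1⟩, ⟨a.1.1, by
      simp only [QSimplex.erase, Finset.mem_erase]
      exact ⟨(hmem a).2.symm, a.1.2⟩⟩⟩) ?_ ?_ ?_ ?_
  · rintro ⟨x, y⟩ -
    have hy := hmem ⟨x, y⟩
    dsimp only at hy ⊢
    have e : (s.erase x).erase y = (s.erase ⟨y.1, hy.1⟩).erase ⟨x.1, by
        simp only [QSimplex.erase, Finset.mem_erase]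
        exact ⟨hy.2.symm, x.2⟩⟩ :=
      Subtype.ext (Finset.erase_right_comm ..)
    rw [e, ← add_smul]
    have := vertexSign_erase_neg x.2 hy.1 hy.2.symm
    simp only [QSimplex.erase] at this ⊢
    rw [this, neg_add_cancel, zero_smul]
  · rintro a - - h
    exact (hmem a).2 (congrArg (fun b => b.1.1) h)
  · intros
    exact Finset.mem_univ _
  · rintro a -
    rfl

/-- The complex `C(N, R)` of oriented chains. The linear order of the vertices serves only to
select one of the two generators `± s` of `C_q(s, R)` for each `q`-simplex `s`; another order gives
an isomorphic complex, the isomorphism changing signs of generators. -/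
noncomputable def orientedComplex (N : PreAbstractSimplicialComplex ι) :
    AugComplex.{v, max u v} R where
  obj q := QSimplex N q →₀ R
  d q := orientedBoundary R N q
  aug := Finsupp.linearCombination R fun _ => (1 : R)
  d_d q c := orientedBoundary_orientedBoundary R N q c
  aug_d c := by
    induction c using Finsupp.induction_linear with
    | zero => simp
    | add a b ha hb => rw [map_add, map_add, ha, hb, add_zero]
    | single s r =>
      have : Finsupp.single s r = r • Finsupp.single s (1 : R) := by simp
      rw [this, map_smul, map_smul, orientedBoundary_single]
      obtain ⟨s, hN, hs⟩ := s
      obtain ⟨x, y, hxy, rfl⟩ := Finset.card_eq_two.mp hs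
      simp only [map_sum, map_zsmul, Finsupp.linearCombination_single, one_smul]
      rw [Finset.sum_coe_sort {x, y} fun z => vertexSign {x, y} z • (1 : R),
        Finset.sum_pair hxy]
      have hv := vertexSign_erase_neg (s := {x, y}) (by simp) (by simp) hxy
      have e1 : ({x, y} : Finset ι).erase x = {y} := Finset.erase_insert (by simpa using hxy)
      have e2 : ({x, y} : Finset ι).erase y = {x} := by
        rw [Finset.pair_comm]
        exact Finset.erase_insert (by simpa using hxy.symm)
      have e3 (z : ι) : vertexSign {z} z = 1 := by
        simp [vertexSign, Finset.filter_singleton]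
      rw [e1, e2, e3, e3, mul_one, mul_one] at hv
      rw [hv, neg_smul, neg_add_cancel, smul_zero]

end Oriented

section ANR

/-- `𝒰` is an open cover of `X`. -/
def IsOpenCovering {X : Type u} [TopologicalSpace X] (𝒰 : Set (Set X)) : Prop :=
  (∀ U ∈ 𝒰, IsOpen U) ∧ ⋃₀ 𝒰 = Set.univ

/-- `(M, μ)` is a partial algebraic realization of `N` in `X` relative to `𝒰`. It is complete when
`M = N`. -/
def IsPartialRealization {R : Type v} [Ring R] {X : Type u} [TopologicalSpace X]
    {ι : Type u} [LinearOrder ι] (𝒰 : Set (Set X)) (N M : PreAbstractSimplicialComplex ι)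
    (μ : (orientedComplex R M).Hom (singularComplex R X)) : Prop :=
  M ≤ N ∧ (∀ x : ι, {x} ∈ N.faces → {x} ∈ M.faces) ∧
    ∀ s ∈ N.faces, ∃ U ∈ 𝒰, ∀ (q : ℕ) (t : QSimplex M q), t.1 ⊆ s →
      chainSupport (R := R) (μ.f q (Finsupp.single t (1 : R))) ⊆ U

/-- `X` is an algebraic absolute neighbourhood `R`-retract. -/
def IsAlgebraicANR (R : Type v) [Ring R] (X : Type u) [TopologicalSpace X] : Prop :=
  TopologicalSpace.MetrizableSpace X ∧
    ∀ 𝒰 : Set (Set X), IsOpenCovering 𝒰 →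
      ∃ 𝒱 : Set (Set X), IsOpenCovering 𝒱 ∧ (∀ V ∈ 𝒱, ∃ U ∈ 𝒰, V ⊆ U) ∧
        ∀ (ι : Type u) [LinearOrder ι] (N M : PreAbstractSimplicialComplex ι)
          (μ : (orientedComplex R M).Hom (singularComplex R X)),
          IsPartialRealization 𝒱 N M μ →
            ∃ ν : (orientedComplex R N).Hom (singularComplex R X),
              IsPartialRealization 𝒰 N N ν ∧
                ∀ (q : ℕ) (t : Finset ι) (hM : t ∈ M.faces ∧ t.card = q + 1)
                  (hN : t ∈ N.faces ∧ t.card = q + 1),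
                  ν.f q (Finsupp.single ⟨t, hN⟩ (1 : R)) = μ.f q (Finsupp.single ⟨t, hM⟩ (1 : R))

end ANR

/-- The graded submodule with components `P p` is generated by finitely many elements. -/
def GradedFinite {R : Type v} [Ring R] {M : ℕ → Type w} [∀ p, AddCommGroup (M p)]
    [∀ p, Module R (M p)] (P : ∀ p, Submodule R (M p)) : Prop :=
  Module.Finite R (DirectSum ℕ fun p => P p)

/-! ### Open covers: star refinements and common refinements. -/

section Covers

variable {X : Type u} [TopologicalSpace X]

/-! Singular chains are turned into oriented chains of a simplicial complex by an iterated cone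
construction, and that complex is then realized in `X`.

Take a fine locally finite open cover indexed by points, and let `lab` send each point to the index
of a member containing it. The apex attached to a singular simplex is the finite set of labels of
its vertices, and `subdivision` cones the subdivided boundary from this apex. The simplices produced
are families of finite subsets of `X` with a common point. Near a compact set only finitely many
labels occur, and degenerate cones are zero, so only finitely many simplices arise in all degrees
together. Since `R` is Noetherian, this gives (ii).

For the realization, a vertex `s` goes to a nearby point `z s` lying in every `X_i` that `s` meets
(`exists_subordinate_points`). A common point of a simplex lies in some `X_i`, so the vertices of
the simplex share a nonempty set `a` of indices, and the simplex can be sought in the ANR `X_a`.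
`exists_labelledRealization` proceeds by decreasing size of `a`: the partial realization already
present in `X_a` is extended by `exists_extension`. For distinct `a` of the same size, the complexes
involved overlap only in vertices and in simplices sharing more indices, all realized earlier, so
the extensions glue. Star refinements at each stage keep the chains small, which gives (i). -/

theorem IsOpenCovering.exists_mem {𝒰 : Set (Set X)} (h : IsOpenCovering 𝒰) (x : X) :
    ∃ U ∈ 𝒰, x ∈ U := by
  have : x ∈ ⋃₀ 𝒰 := h.2 ▸ Set.mem_univ x
  simpa using this

/-- Every open cover of a metrizable space has an open star refinement. -/
theorem IsOpenCovering.exists_star_refinement [TopologicalSpace.MetrizableSpace X]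
    {𝒰 : Set (Set X)} (h : IsOpenCovering 𝒰) :
    ∃ 𝒱 : Set (Set X), IsOpenCovering 𝒱 ∧
      ∀ V ∈ 𝒱, ∃ U ∈ 𝒰, ∀ V' ∈ 𝒱, (V ∩ V').Nonempty → V' ⊆ U := by
  let := TopologicalSpace.metrizableSpaceMetric X
  -- The bound 1 keeps the supremum finite. Nonpositive radii are admitted, so `ρ - dist x y`
  -- qualifies below whatever its sign; hence the supremum is 1-Lipschitz in `x`.
  let S : X → Set ℝ := fun x => {ρ | ρ ≤ 1 ∧ ∃ U ∈ 𝒰, Metric.ball x ρ ⊆ U}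
  have hb (x : X) : BddAbove (S x) := ⟨1, fun ρ hρ => hρ.1⟩
  have hpos (x : X) : ∃ ρ ∈ S x, 0 < ρ := by
    obtain ⟨U, hU, hx⟩ := h.exists_mem x
    obtain ⟨ε, hε, hεU⟩ := Metric.isOpen_iff.mp (h.1 U hU) x hx
    exact ⟨min ε 1, ⟨min_le_right _ _, U, hU,
      (Metric.ball_subset_ball (min_le_left _ _)).trans hεU⟩, by positivity⟩
  have hne (x : X) : (S x).Nonempty := (hpos x).imp fun _ h => h.1
  have hr (x : X) : 0 < sSup (S x) := by
    obtain ⟨ρ, hρ, h0⟩ := hpos x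
    exact h0.trans_le (le_csSup (hb x) hρ)
  have hlip (x y : X) : sSup (S x) ≤ sSup (S y) + dist x y := by
    refine csSup_le (hne x) fun ρ hρ => ?_
    obtain ⟨hρ1, U, hU, hρU⟩ := hρ
    rw [← sub_le_iff_le_add]
    refine le_csSup (hb y) ⟨by linarith [dist_nonneg (x := x) (y := y)], U, hU, fun z hz => hρU ?_⟩
    rw [Metric.mem_ball] at hz ⊢
    linarith [dist_triangle z y x, dist_comm x y]
  -- With radii `r/8`, meeting balls satisfy `r y < (9/7) r x`, so the second lies within `r y / 4 +
  -- r x / 8 < r x / 2` of `x`.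
  refine ⟨Set.range fun x => Metric.ball x (sSup (S x) / 8), ⟨?_, ?_⟩, ?_⟩
  · rintro _ ⟨x, rfl⟩
    exact Metric.isOpen_ball
  · refine Set.eq_univ_of_forall fun x => ⟨_, ⟨x, rfl⟩, Metric.mem_ball_self (by linarith [hr x])⟩
  · rintro _ ⟨x, rfl⟩
    obtain ⟨ρ, ⟨-, U, hU, hρU⟩, hρ⟩ := exists_lt_of_lt_csSup (hne x) (half_lt_self (hr x))
    refine ⟨U, hU, ?_⟩
    rintro _ ⟨y, rfl⟩ ⟨z, hzx, hzy⟩ w hw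
    refine hρU ?_
    simp only [Metric.mem_ball] at *
    have h1 := hlip y x
    have h2 := dist_triangle y z x
    have h3 := dist_triangle w y x
    have h4 := dist_comm y z
    linarith [hr x, hr y]

/-- Finitely many open covers have a common open refinement. -/
theorem exists_common_refinement {α : Type*} [Finite α] (𝒰 : α → Set (Set X))
    (h : ∀ a, IsOpenCovering (𝒰 a)) :
    ∃ 𝒱 : Set (Set X), IsOpenCovering 𝒱 ∧ ∀ a, ∀ V ∈ 𝒱, ∃ U ∈ 𝒰 a, V ⊆ U := by
  refine ⟨{V | IsOpen V ∧ ∀ a, ∃ U ∈ 𝒰 a, V ⊆ U}, ⟨fun V hV => hV.1, ?_⟩, fun a V hV => hV.2 a⟩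
  refine Set.eq_univ_of_forall fun x => ?_
  choose U hU hx using fun a => (h a).exists_mem x
  exact ⟨⋂ a, U a, ⟨isOpen_iInter_of_finite fun a => (h a).1 _ (hU a),
    fun a => ⟨U a, hU a, Set.iInter_subset _ a⟩⟩, Set.mem_iInter.mpr hx⟩

end Covers

/-! ### Cones on augmented oriented chains of the full simplex. -/

section ExteriorChains

variable {ι : Type*} [LinearOrder ι] (R : Type v) [Ring R]

theorem vertexSign_mul_self (s : Finset ι) (x : ι) : vertexSign s x * vertexSign s x = 1 := by
  rw [vertexSign, ← mul_pow]
  simp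

/-- The boundary on the free module generated by all finite sets of vertices, the empty set
included; in degree zero it is the augmentation. -/
noncomputable def finsetBoundary : (Finset ι →₀ R) →ₗ[R] (Finset ι →₀ R) :=
  Finsupp.linearCombination R fun t => ∑ x ∈ t, vertexSign t x • Finsupp.single (t.erase x) (1 : R)

theorem finsetBoundary_single (t : Finset ι) :
    finsetBoundary R (Finsupp.single t 1) =
      ∑ x ∈ t, vertexSign t x • Finsupp.single (t.erase x) (1 : R) := by
  simp [finsetBoundary]

/-- The cone with apex `v`. -/
noncomputable def finsetCone (v : ι) : (Finset ι →₀ R) →ₗ[R] (Finset ι →₀ R) :=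
  Finsupp.linearCombination R fun t =>
    if v ∈ t then 0 else vertexSign (insert v t) v • Finsupp.single (insert v t) (1 : R)

theorem finsetCone_single (v : ι) (t : Finset ι) :
    finsetCone R v (Finsupp.single t 1) =
      if v ∈ t then 0 else vertexSign (insert v t) v • Finsupp.single (insert v t) (1 : R) := by
  simp [finsetCone]

/-- The cone is a contracting homotopy. If `v ∈ t`, only the face opposite `v` has a nonzero cone,
and it gives back `t`; otherwise the terms other than `t` cancel in pairs by antisymmetry of the
signs. Admitting `∅` makes the formula uniform down to degree zero. -/
theorem finsetBoundary_finsetCone (v : ι) (c : Finset ι →₀ R) :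
    finsetBoundary R (finsetCone R v c) = c - finsetCone R v (finsetBoundary R c) := by
  rw [eq_sub_iff_add_eq]
  suffices h : finsetBoundary R ∘ₗ finsetCone R v + finsetCone R v ∘ₗ finsetBoundary R =
      LinearMap.id from LinearMap.congr_fun h c
  refine Finsupp.lhom_ext' fun t => LinearMap.ext_ring ?_
  simp only [LinearMap.comp_apply, LinearMap.add_apply, Finsupp.lsingle_apply, LinearMap.id_apply,
    finsetBoundary_single, finsetCone_single, map_sum, map_zsmul]
  by_cases hv : v ∈ t
  · rw [if_pos hv, map_zero, zero_add, Finset.sum_eq_single_of_mem v hv]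
    · rw [if_neg (Finset.notMem_erase v t), Finset.insert_erase hv, smul_smul,
        vertexSign_mul_self, one_smul]
    · intro x _ hxv
      rw [if_pos (Finset.mem_erase.mpr ⟨hxv.symm, hv⟩), smul_zero]
  · rw [if_neg hv, map_zsmul, finsetBoundary_single, Finset.sum_insert hv,
      Finset.erase_insert hv, smul_add, smul_smul, vertexSign_mul_self, one_smul, add_assoc,
      add_eq_left, Finset.smul_sum, ← Finset.sum_add_distrib]
    refine Finset.sum_eq_zero fun x hx => ?_
    have hxv : v ≠ x := fun e => hv (e ▸ hx)
    have e1 : (insert v t).erase x = insert v (t.erase x) := Finset.erase_insert_of_ne hxv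
    rw [if_neg fun h => hv (Finset.mem_of_mem_erase h), smul_smul, smul_smul, e1, ← add_smul]
    have h := vertexSign_erase_neg (Finset.mem_insert_self v t) (Finset.mem_insert_of_mem hx) hxv
    rw [Finset.erase_insert hv, e1] at h
    have h1 := vertexSign_mul_self (insert v t) v
    have h2 := vertexSign_mul_self (insert v t) x
    have h3 := vertexSign_mul_self t x
    have h4 := vertexSign_mul_self (insert v (t.erase x)) v
    generalize vertexSign (insert v t) v = a at *
    generalize vertexSign (insert v t) x = b at *
    generalize vertexSign t x = c at *
    generalize vertexSign (insert v (t.erase x)) v = d at *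
    -- Multiply `a * c = -(b * d)` by `b * c` and use that `b` and `c` square to 1.
    have : a * b + c * d = 0 := by
      linear_combination (b * c) * h - a * b * h3 + (- c * d) * h2
    rw [this, zero_smul]

end ExteriorChains

/-! ### Chains of a subspace versus chains of the ambient space. -/

section Subspaces

variable {X : Type u} [TopologicalSpace X] (R : Type v) [Ring R] {A : Set X}

theorem chainSupport_subset_iff {p : ℕ} {c : SingularSimplex X p →₀ R} :
    chainSupport c ⊆ A ↔ ∀ σ ∈ c.support, Set.range σ ⊆ A :=
  Set.iUnion₂_subset_iff

theorem singularBoundary_mem_chainsIn {p : ℕ} {c : SingularSimplex X (p + 1) →₀ R}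
    (hc : c ∈ chainsIn R A (p + 1)) : singularBoundary R p c ∈ chainsIn R A p := by
  have e (q : ℕ) : chainsIn R A q = smallChains R {A} q := by simp [chainsIn, smallChains]
  rw [e] at hc ⊢
  exact singularBoundary_mem_smallChains R _ p c hc

/-- The augmentation of singular chains. -/
noncomputable def singularAug (X : Type u) [TopologicalSpace X] :
    (SingularSimplex X 0 →₀ R) →ₗ[R] R :=
  Finsupp.linearCombination R fun _ => (1 : R)

theorem singularAug_single (σ : SingularSimplex X 0) :
    singularAug R X (Finsupp.single σ 1) = 1 := by
  simp [singularAug]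

theorem singularAug_singularBoundary (c : SingularSimplex X 1 →₀ R) :
    singularAug R X (singularBoundary R 0 c) = 0 :=
  (singularComplex R X).aug_d c

/-- The chain map induced by the inclusion of a subspace. -/
noncomputable def inclusionChains (A : Set X) (p : ℕ) :
    (SingularSimplex A p →₀ R) →ₗ[R] (SingularSimplex X p →₀ R) :=
  Finsupp.lmapDomain R R fun σ => (⟨Subtype.val, continuous_subtype_val⟩ : C(A, X)).comp σ

open Classical in
/-- The projection of the chains of a space onto the chains of a subspace which annihilates the
simplices not contained in the subspace. -/
noncomputable def restrictChains (A : Set X) (p : ℕ) :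
    (SingularSimplex X p →₀ R) →ₗ[R] (SingularSimplex A p →₀ R) :=
  Finsupp.linearCombination R fun σ =>
    if h : ∀ x, σ x ∈ A then Finsupp.single ⟨fun x => ⟨σ x, h x⟩, by fun_prop⟩ 1 else 0

theorem inclusionChains_single (p : ℕ) (σ : SingularSimplex A p) (r : R) :
    inclusionChains R A p (Finsupp.single σ r) =
      Finsupp.single ((⟨Subtype.val, continuous_subtype_val⟩ : C(A, X)).comp σ) r := by
  simp [inclusionChains]

theorem inclusionChains_injective (p : ℕ) : Function.Injective (inclusionChains R A p) := by
  refine Finsupp.mapDomain_injective fun σ τ h => ContinuousMap.ext fun x => Subtype.ext ?_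
  exact DFunLike.congr_fun h x

theorem singularBoundary_inclusionChains (p : ℕ) (c : SingularSimplex A (p + 1) →₀ R) :
    singularBoundary R p (inclusionChains R A (p + 1) c) =
      inclusionChains R A p (singularBoundary R p c) := by
  suffices h : singularBoundary R p ∘ₗ inclusionChains R A (p + 1) =
      inclusionChains R A p ∘ₗ singularBoundary R p from LinearMap.congr_fun h c
  refine Finsupp.lhom_ext' fun σ => LinearMap.ext_ring ?_
  simp only [LinearMap.comp_apply, Finsupp.lsingle_apply, inclusionChains_single,
    singularBoundary_single, map_sum, map_zsmul, ContinuousMap.comp_assoc]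

theorem aug_inclusionChains (c : SingularSimplex A 0 →₀ R) :
    singularAug R X (inclusionChains R A 0 c) = singularAug R A c := by
  change Finsupp.linearCombination R _ (Finsupp.mapDomain _ c) = _
  rw [Finsupp.linearCombination_mapDomain]
  rfl

theorem chainSupport_inclusionChains (p : ℕ) (c : SingularSimplex A p →₀ R) :
    chainSupport (inclusionChains R A p c) ⊆ Subtype.val '' chainSupport c := by
  classical
  refine (chainSupport_subset_iff R).mpr fun σ hσ => ?_
  obtain ⟨τ, hτ, rfl⟩ := Finset.mem_image.mp (Finsupp.mapDomain_support hσ)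
  rintro _ ⟨x, rfl⟩
  exact ⟨τ x, Set.mem_biUnion hτ ⟨x, rfl⟩, rfl⟩

theorem inclusionChains_restrictChains {p : ℕ} {c : SingularSimplex X p →₀ R}
    (hc : c ∈ chainsIn R A p) : inclusionChains R A p (restrictChains R A p c) = c := by
  rw [chainsIn, Finsupp.supported_eq_span_single] at hc
  induction hc using Submodule.span_induction with
  | mem c hc =>
    obtain ⟨σ, hσ, rfl⟩ := hc
    have h : ∀ x, σ x ∈ A := fun x => hσ ⟨x, rfl⟩
    simp only [restrictChains, Finsupp.linearCombination_single, one_smul, dif_pos h,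
      inclusionChains_single]
    rfl
  | zero => simp
  | add a b _ _ ha hb => rw [map_add, map_add, ha, hb]
  | smul r a _ ha => rw [map_smul, map_smul, ha]

/-- The projection is not a chain map on all chains, since a simplex outside `A` may have faces in
`A`. On chains in `A` it inverts the inclusion, which is an injective chain map. -/
theorem singularBoundary_restrictChains {p : ℕ} {c : SingularSimplex X (p + 1) →₀ R}
    (hc : c ∈ chainsIn R A (p + 1)) :
    singularBoundary R p (restrictChains R A (p + 1) c) =
      restrictChains R A p (singularBoundary R p c) := by
  apply inclusionChains_injective
  rw [← singularBoundary_inclusionChains, inclusionChains_restrictChains R hc,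
    inclusionChains_restrictChains R (singularBoundary_mem_chainsIn R hc)]

theorem aug_restrictChains {c : SingularSimplex X 0 →₀ R} (hc : c ∈ chainsIn R A 0) :
    singularAug R A (restrictChains R A 0 c) = singularAug R X c := by
  rw [← aug_inclusionChains, inclusionChains_restrictChains R hc]

theorem chainSupport_restrictChains {p : ℕ} {c : SingularSimplex X p →₀ R} :
    chainSupport (restrictChains R A p c) ⊆ Subtype.val ⁻¹' chainSupport c := by
  rw [← mem_chainsIn_iff, restrictChains, Finsupp.linearCombination_apply]
  refine Submodule.sum_mem _ fun σ hσ => Submodule.smul_mem _ _ ?_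
  split_ifs with h
  · refine Finsupp.single_mem_supported R 1 ?_
    rintro _ ⟨x, rfl⟩
    exact Set.mem_biUnion hσ ⟨x, rfl⟩
  · exact Submodule.zero_mem _

end Subspaces

/-! ### Chain maps from oriented chains as families of chains indexed by finite sets. -/

section Realizations

variable {X : Type u} [TopologicalSpace X] {R : Type v} [Ring R] {ι : Type*} [LinearOrder ι]

/-- `g` assigns chains to the simplices in `K` compatibly with boundary and augmentation; `g q t`
matters only for the `q`-simplices `t` in `K`. -/
def IsChainRealization (K : Set (Finset ι)) (g : ∀ q, Finset ι → (SingularSimplex X q →₀ R)) :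
    Prop :=
  (∀ x, {x} ∈ K → singularAug R X (g 0 {x}) = 1) ∧
    ∀ q, ∀ t ∈ K, t.card = q + 2 →
      singularBoundary R q (g (q + 1) t) = ∑ x ∈ t, vertexSign t x • g q (t.erase x)

theorem PreAbstractSimplicialComplex.erase_mem_faces {K : PreAbstractSimplicialComplex ι}
    {t : Finset ι} (ht : t ∈ K.faces) {q : ℕ} (hq : t.card = q + 2) {x : ι} (hx : x ∈ t) :
    t.erase x ∈ K.faces ∧ (t.erase x).card = q + 1 := by
  have h : (t.erase x).card = q + 1 := by
    rw [Finset.card_erase_of_mem hx, hq]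
    rfl
  exact ⟨(K.isRelLowerSet_faces ht).2 (Finset.erase_subset _ _) (Finset.card_pos.mp (by omega)), h⟩

/-- The chain map determined by the chains assigned to the simplices. -/
noncomputable def IsChainRealization.hom {ι : Type u} [LinearOrder ι]
    {K : PreAbstractSimplicialComplex ι} {g : ∀ q, Finset ι → (SingularSimplex X q →₀ R)}
    (hg : IsChainRealization K.faces g) : (orientedComplex R K).Hom (singularComplex R X) where
  f q := Finsupp.linearCombination R fun t : QSimplex K q => g q t.1
  f_d q c := by
    change ((Finsupp.linearCombination R fun t : QSimplex K q => g q t.1) ∘ₗ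
      orientedBoundary R K q) c = (singularBoundary R q ∘ₗ
        Finsupp.linearCombination R fun t : QSimplex K (q + 1) => g (q + 1) t.1) c
    refine LinearMap.congr_fun (Finsupp.lhom_ext' fun t => LinearMap.ext_ring ?_) c
    simp only [LinearMap.comp_apply, Finsupp.lsingle_apply, orientedBoundary_single, map_sum,
      map_zsmul, Finsupp.linearCombination_single, one_smul]
    rw [hg.2 q t.1 t.2.1 t.2.2]
    exact Finset.sum_coe_sort t.1 fun x => vertexSign t.1 x • g q (t.1.erase x)
  aug_f c := by
    change (singularAug R X ∘ₗ Finsupp.linearCombination R fun t : QSimplex K 0 => g 0 t.1) c =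
      (Finsupp.linearCombination R fun _ : QSimplex K 0 => (1 : R)) c
    refine LinearMap.congr_fun (Finsupp.lhom_ext' fun t => LinearMap.ext_ring ?_) c
    obtain ⟨x, hx⟩ := Finset.card_eq_one.mp t.2.2
    simp only [LinearMap.comp_apply, Finsupp.lsingle_apply, Finsupp.linearCombination_single,
      one_smul]
    rw [hx]
    exact hg.1 x (hx ▸ t.2.1)

theorem IsChainRealization.hom_single {ι : Type u} [LinearOrder ι]
    {K : PreAbstractSimplicialComplex ι} {g : ∀ q, Finset ι → (SingularSimplex X q →₀ R)}
    (hg : IsChainRealization K.faces g) (q : ℕ) (t : QSimplex K q) :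
    hg.hom.f q (Finsupp.single t (1 : R)) = g q t.1 :=
  (Finsupp.linearCombination_single R (1 : R) t).trans (one_smul R _)

open Classical in
/-- The chains assigned to the simplices by a chain map. -/
noncomputable def AugComplex.Hom.chains {ι : Type u} [LinearOrder ι]
    {K : PreAbstractSimplicialComplex ι}
    (ν : (orientedComplex R K).Hom (singularComplex R X)) (q : ℕ) (t : Finset ι) :
    SingularSimplex X q →₀ R :=
  if h : t ∈ K.faces ∧ t.card = q + 1 then ν.f q (Finsupp.single ⟨t, h⟩ (1 : R)) else 0

theorem AugComplex.Hom.chains_of_mem {ι : Type u} [LinearOrder ι]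
    {K : PreAbstractSimplicialComplex ι} (ν : (orientedComplex R K).Hom (singularComplex R X))
    {q : ℕ} {t : Finset ι} (h : t ∈ K.faces ∧ t.card = q + 1) :
    ν.chains q t = ν.f q (Finsupp.single ⟨t, h⟩ (1 : R)) :=
  dif_pos h

theorem AugComplex.Hom.isChainRealization {ι : Type u} [LinearOrder ι]
    {K : PreAbstractSimplicialComplex ι}
    (ν : (orientedComplex R K).Hom (singularComplex R X)) :
    IsChainRealization K.faces ν.chains := by
  refine ⟨fun x hx => ?_, fun q t ht hq => ?_⟩
  · rw [ν.chains_of_mem ⟨hx, Finset.card_singleton x⟩]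
    refine (ν.aug_f _).trans ?_
    exact (Finsupp.linearCombination_single R (1 : R) _).trans (one_smul R _)
  · rw [ν.chains_of_mem ⟨ht, hq⟩]
    refine (ν.f_d q _).symm.trans ?_
    refine (congrArg (ν.f q) (orientedBoundary_single R K q ⟨t, ht, hq⟩)).trans ?_
    refine ((map_sum (ν.f q) _ _).trans (Finset.sum_congr rfl fun x _ => ?_)).trans
      (Finset.sum_coe_sort t fun x => vertexSign t x • ν.chains q (t.erase x))
    rw [ν.chains_of_mem (K.erase_mem_faces ht hq x.2)]
    exact map_zsmul (ν.f q) _ _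

end Realizations

/-! ### Extension of realizations inside a closed algebraic ANR. -/

section Extension

variable {X : Type u} [TopologicalSpace X] {R : Type v} [Ring R]

theorem IsChainRealization.inclusionChains {ι : Type*} [LinearOrder ι] {K : Set (Finset ι)}
    {A : Set X} {g : ∀ q, Finset ι → (SingularSimplex A q →₀ R)} (hg : IsChainRealization K g) :
    IsChainRealization K fun q t => inclusionChains R A q (g q t) := by
  refine ⟨fun x hx => (aug_inclusionChains R _).trans (hg.1 x hx), fun q t ht hq => ?_⟩
  rw [singularBoundary_inclusionChains, hg.2 q t ht hq, map_sum]
  simp only [map_zsmul]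

theorem IsChainRealization.restrictChains {ι : Type*} [LinearOrder ι]
    {K : PreAbstractSimplicialComplex ι}
    {A : Set X} {g : ∀ q, Finset ι → (SingularSimplex X q →₀ R)}
    (hg : IsChainRealization K.faces g)
    (hA : ∀ q, ∀ t ∈ K.faces, t.card = q + 1 → g q t ∈ chainsIn R A q) :
    IsChainRealization K.faces fun q t => restrictChains R A q (g q t) := by
  refine ⟨fun x hx => (aug_restrictChains R (hA 0 _ hx (Finset.card_singleton x))).trans (hg.1 x hx),
    fun q t ht hq => ?_⟩
  rw [singularBoundary_restrictChains R (hA (q + 1) t ht hq), hg.2 q t ht hq, map_sum]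
  simp only [map_zsmul]

theorem chainSupport_inclusionChains_subset {A : Set X} {p : ℕ} {c : SingularSimplex A p →₀ R} :
    chainSupport (inclusionChains R A p c) ⊆ A :=
  (chainSupport_inclusionChains R p c).trans (Subtype.coe_image_subset _ _)

/-- Partial realizations in a closed algebraic ANR `A` which are small with respect to an open cover
of the ambient space extend to complete ones. -/
theorem exists_extension {A : Set X} (hA : IsClosed A) (hANR : A.Nonempty → IsAlgebraicANR R A)
    {𝒰 : Set (Set X)} (h𝒰 : IsOpenCovering 𝒰) :
    ∃ 𝒱 : Set (Set X), IsOpenCovering 𝒱 ∧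
      ∀ (ι : Type u) [LinearOrder ι] (N M : PreAbstractSimplicialComplex ι)
        (g : ∀ q, Finset ι → (SingularSimplex X q →₀ R)), M ≤ N →
        (∀ x, {x} ∈ N.faces → {x} ∈ M.faces) → (∀ t ∈ N.faces, A.Nonempty) →
        IsChainRealization M.faces g →
        (∀ q, ∀ t ∈ M.faces, t.card = q + 1 → g q t ∈ chainsIn R A q) →
        (∀ s ∈ N.faces, ∃ V ∈ 𝒱, ∀ q, ∀ t ∈ M.faces, t.card = q + 1 → t ⊆ s →
          chainSupport (g q t) ⊆ V) →
        ∃ g' : ∀ q, Finset ι → (SingularSimplex X q →₀ R), IsChainRealization N.faces g' ∧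
          (∀ q, ∀ t ∈ M.faces, t.card = q + 1 → g' q t = g q t) ∧
          (∀ q, ∀ t ∈ N.faces, t.card = q + 1 → g' q t ∈ chainsIn R A q) ∧
          ∀ s ∈ N.faces, ∃ U ∈ 𝒰, ∀ q, ∀ t ∈ N.faces, t.card = q + 1 → t ⊆ s →
            chainSupport (g' q t) ⊆ U := by
  rcases A.eq_empty_or_nonempty with hAe | hAne
  -- For empty `A` no ANR property is available, but `N` then has no simplices.
  · refine ⟨𝒰, h𝒰, fun ι _ N M g _ _ hne _ _ _ => ?_⟩
    have hN (t) (ht : t ∈ N.faces) : False := (hne t ht).ne_empty hAe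
    exact ⟨g, ⟨fun x hx => (hN _ hx).elim, fun q t ht => (hN t ht).elim⟩, fun q t _ _ => rfl,
      fun q t ht => (hN t ht).elim, fun t ht => (hN t ht).elim⟩
  obtain ⟨𝒱', h𝒱', -, hext⟩ := (hANR hAne).2 {U' | ∃ U ∈ 𝒰, U' = Subtype.val ⁻¹' U} <| by
    refine ⟨?_, Set.eq_univ_of_forall fun a => ?_⟩
    · rintro _ ⟨U, hU, rfl⟩
      exact (h𝒰.1 U hU).preimage continuous_subtype_val
    · obtain ⟨U, hU, ha⟩ := h𝒰.exists_mem a.1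
      exact ⟨_, ⟨U, hU, rfl⟩, ha⟩
  -- Only the trace on `A` is constrained. As `A` is closed, its complement, with empty trace, is a
  -- member and covers the points outside `A`.
  refine ⟨{V | IsOpen V ∧ ∃ V' ∈ 𝒱', (Subtype.val : A → X) ⁻¹' V ⊆ V'}, ⟨fun V hV => hV.1, ?_⟩, ?_⟩
  · refine Set.eq_univ_of_forall fun x => ?_
    by_cases hx : x ∈ A
    · obtain ⟨V', hV', hxV⟩ := h𝒱'.exists_mem ⟨x, hx⟩
      obtain ⟨V, hV, rfl⟩ := isOpen_induced_iff.mp (h𝒱'.1 V' hV')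
      exact ⟨V, ⟨hV, _, hV', subset_rfl⟩, hxV⟩
    · obtain ⟨V', hV', -⟩ := h𝒱'.exists_mem ⟨_, hAne.some_mem⟩
      exact ⟨Aᶜ, ⟨hA.isOpen_compl, V', hV', fun a ha => (ha a.2).elim⟩, hx⟩
  intro ι _ N M g hMN hvert _ hg hgA hsmall
  have hg' := hg.restrictChains hgA
  obtain ⟨ν, hν, hνμ⟩ := hext ι N M hg'.hom <| by
    refine ⟨hMN, hvert, fun s hs => ?_⟩
    obtain ⟨V, ⟨-, V', hV', hVV'⟩, hV⟩ := hsmall s hs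
    refine ⟨V', hV', fun q t hts => ?_⟩
    rw [hg'.hom_single]
    exact (chainSupport_restrictChains R).trans
      ((Set.preimage_mono (hV q t.1 t.2.1 t.2.2 hts)).trans hVV')
  refine ⟨_, ν.isChainRealization.inclusionChains, fun q t ht hq => ?_, fun q t _ _ => ?_,
    fun s hs => ?_⟩
  · have hM : t ∈ M.faces ∧ t.card = q + 1 := ⟨ht, hq⟩
    rw [ν.chains_of_mem ⟨hMN ht, hq⟩, hνμ q t hM, hg'.hom_single q ⟨t, hM⟩,
      inclusionChains_restrictChains R (hgA q t ht hq)]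
  · exact (mem_chainsIn_iff R).mpr chainSupport_inclusionChains_subset
  · obtain ⟨_, ⟨U, hU, rfl⟩, h⟩ := hν.2.2 s hs
    refine ⟨U, hU, fun q t ht hq hts => (chainSupport_inclusionChains R q _).trans ?_⟩
    rw [Set.image_subset_iff, ν.chains_of_mem ⟨ht, hq⟩]
    exact h q ⟨t, ht, hq⟩ hts

end Extension

/-! ### Realization by decreasing number of shared labels. -/

section Tower

variable {X : Type u} [TopologicalSpace X] {R : Type v} [Ring R]

theorem chainSupport_single [Nontrivial R] {p : ℕ} (σ : SingularSimplex X p) :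
    chainSupport (Finsupp.single σ (1 : R)) = Set.range σ := by
  simp [chainSupport]

/-- The subcomplex of the simplices with a property inherited by faces. -/
def PreAbstractSimplicialComplex.sep {ι : Type*} (L : PreAbstractSimplicialComplex ι)
    (P : Finset ι → Prop) (hP : ∀ t t', t' ⊆ t → t'.Nonempty → P t → P t') :
    PreAbstractSimplicialComplex ι where
  faces := {t ∈ L.faces | P t}
  isRelLowerSet_faces := fun t ht => ⟨(L.isRelLowerSet_faces ht.1).1, fun t' htt' ht' =>
    ⟨(L.isRelLowerSet_faces ht.1).2 htt' ht', hP t t' htt' ht' ht.2⟩⟩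

variable {α : Type*} [Fintype α] [DecidableEq α]

/-- The subcomplex of the vertices and of the simplices whose vertices share at least
`card α + 1 - m` labels. -/
def sharedLabels {ι : Type*} (L : PreAbstractSimplicialComplex ι) (l : ι → Finset α) (m : ℕ) :
    PreAbstractSimplicialComplex ι :=
  L.sep (fun t => t.card = 1 ∨ Fintype.card α + 1 ≤ (t.inf l).card + m) <| by
    rintro t t' htt' ht' (h | h)
    · have := Finset.card_le_card htt'
      have := Finset.card_pos.mpr ht'
      omega
    · have : (t.inf l).card ≤ (t'.inf l).card := Finset.card_le_card (Finset.inf_mono htt')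
      omega

/-- The subcomplex of the simplices whose vertices all have the labels in `a`. -/
def withLabels {ι : Type*} (L : PreAbstractSimplicialComplex ι) (l : ι → Finset α)
    (a : Finset α) : PreAbstractSimplicialComplex ι :=
  L.sep (fun t => a ⊆ t.inf l) fun _ _ htt' _ h => h.trans (Finset.inf_mono htt')

/-- `g` realizes the simplices of `K` by chains in the spaces prescribed by their labels, their
vertices by the points `z`, with smallness controlled by `𝒰`. -/
structure IsLabelledRealization {ι : Type*} [LinearOrder ι] (A : Finset α → Set X)
    (𝒰 : Set (Set X)) (K : PreAbstractSimplicialComplex ι) (l : ι → Finset α) (z : ι → X)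
    (g : ∀ q, Finset ι → (SingularSimplex X q →₀ R)) : Prop where
  chain : IsChainRealization K.faces g
  mem : ∀ q, ∀ t ∈ K.faces, t.card = q + 1 → g q t ∈ chainsIn R (A (t.inf l)) q
  vertex : ∀ x, {x} ∈ K.faces → g 0 {x} = Finsupp.single (ContinuousMap.const _ (z x)) 1
  small : ∀ t ∈ K.faces, ∃ U ∈ 𝒰, (∀ x ∈ t, z x ∈ U) ∧
    ∀ q, t.card = q + 1 → chainSupport (g q t) ⊆ U

/-- A labelled realization controls each simplex separately, whereas a partial realization needs one
set for all faces of `s`. Each face's set contains some `z x` and so meets the set `V` holding all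
these points; the star of `V` serves. -/
theorem IsLabelledRealization.small_faces {ι : Type*} [LinearOrder ι] {A : Finset α → Set X}
    {𝒰 𝒱 : Set (Set X)} {K : PreAbstractSimplicialComplex ι} {l : ι → Finset α} {z : ι → X}
    {g : ∀ q, Finset ι → (SingularSimplex X q →₀ R)} (hg : IsLabelledRealization A 𝒱 K l z g)
    (h𝒱 : ∀ V ∈ 𝒱, ∃ U ∈ 𝒰, ∀ V' ∈ 𝒱, (V ∩ V').Nonempty → V' ⊆ U) {s : Finset ι}
    (hs : ∃ V ∈ 𝒱, ∀ x ∈ s, z x ∈ V) :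
    ∃ U ∈ 𝒰, ∀ q, ∀ t ∈ K.faces, t.card = q + 1 → t ⊆ s → chainSupport (g q t) ⊆ U := by
  obtain ⟨V, hV, hsV⟩ := hs
  obtain ⟨U, hU, hstar⟩ := h𝒱 V hV
  refine ⟨U, hU, fun q t ht hq hts => ?_⟩
  obtain ⟨V', hV', hzV', htV'⟩ := hg.small t ht
  obtain ⟨x, hx⟩ := (K.isRelLowerSet_faces ht).1
  exact (htV' q hq).trans (hstar V' hV' ⟨z x, hsV x (hts hx), hzV' x hx⟩)

/-- The start of the induction: no simplex shares `card α + 1` labels, so only vertices are present.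
The values in positive degrees are immaterial. -/
theorem isLabelledRealization_vertices {ι : Type*} [LinearOrder ι] {A : Finset α → Set X}
    {𝒰 : Set (Set X)} {L : PreAbstractSimplicialComplex ι} {l : ι → Finset α} {z : ι → X}
    (hz : ∀ x, {x} ∈ L.faces → z x ∈ A (l x)) (hsmall : ∀ t ∈ L.faces, ∃ V ∈ 𝒰, ∀ x ∈ t, z x ∈ V) :
    ∃ g : ∀ q, Finset ι → (SingularSimplex X q →₀ R),
      IsLabelledRealization A 𝒰 (sharedLabels L l 0) l z g := by
  have hcard (t) (ht : t ∈ (sharedLabels L l 0).faces) : t.card = 1 := by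
    refine ht.2.resolve_right fun h => ?_
    have := Finset.card_le_univ (t.inf l)
    omega
  let g : ∀ q, Finset ι → (SingularSimplex X q →₀ R)
    | 0, t => ∑ x ∈ t, Finsupp.single (ContinuousMap.const _ (z x)) 1
    | _ + 1, _ => 0
  have hg (x : ι) : g 0 {x} = Finsupp.single (ContinuousMap.const _ (z x)) 1 :=
    Finset.sum_singleton _ _
  have hmem {S : Set X} {x : ι} (hx : z x ∈ S) : g 0 {x} ∈ chainsIn R S 0 := by
    rw [hg]
    refine Finsupp.single_mem_supported R 1 ?_
    rintro _ ⟨y, rfl⟩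
    exact hx
  refine ⟨g, ⟨fun x _ => by rw [hg, singularAug_single], fun q t ht hq => ?_⟩, fun q t ht hq => ?_,
    fun x _ => hg x, fun t ht => ?_⟩
  · have := hcard t ht
    omega
  · have h1 := hcard t ht
    obtain ⟨x, rfl⟩ := Finset.card_eq_one.mp h1
    obtain rfl : q = 0 := by omega
    rw [Finset.inf_singleton]
    exact hmem (hz x ht.1)
  · obtain ⟨U, hU, hzU⟩ := hsmall t ht.1
    refine ⟨U, hU, hzU, fun q hq => ?_⟩
    have h1 := hcard t ht
    obtain ⟨x, rfl⟩ := Finset.card_eq_one.mp h1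
    obtain rfl : q = 0 := by omega
    exact (mem_chainsIn_iff R).mp (hmem (hzU x (Finset.mem_singleton_self x)))

/-- Realizations of the simplices sharing more labels extend over those sharing one label less. -/
theorem exists_labelledRealization_succ [Nontrivial R] {A : Finset α → Set X}
    (hA : ∀ a, IsClosed (A a)) (hmono : ∀ a b, a ⊆ b → A b ⊆ A a)
    (hANR : ∀ a, a.Nonempty → (A a).Nonempty → IsAlgebraicANR R (A a))
    {m : ℕ} (hm : m < Fintype.card α) {𝒰 : Set (Set X)} (h𝒰 : IsOpenCovering 𝒰) :
    ∃ 𝒱 : Set (Set X), IsOpenCovering 𝒱 ∧ (∀ V ∈ 𝒱, ∃ U ∈ 𝒰, V ⊆ U) ∧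
      ∀ 𝒲 : Set (Set X), (∀ W ∈ 𝒲, ∃ V ∈ 𝒱, ∀ W' ∈ 𝒲, (W ∩ W').Nonempty → W' ⊆ V) →
      ∀ (ι : Type u) [LinearOrder ι] (L : PreAbstractSimplicialComplex ι) (l : ι → Finset α)
        (z : ι → X) (g : ∀ q, Finset ι → (SingularSimplex X q →₀ R)),
        (∀ x, {x} ∈ L.faces → z x ∈ A (l x)) →
        (∀ t ∈ L.faces, ∃ W ∈ 𝒲, ∀ x ∈ t, z x ∈ W) →
        IsLabelledRealization A 𝒲 (sharedLabels L l m) l z g →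
        ∃ g' : ∀ q, Finset ι → (SingularSimplex X q →₀ R),
          IsLabelledRealization A 𝒰 (sharedLabels L l (m + 1)) l z g' := by
  classical
  have hex (a : {a : Finset α // a.Nonempty}) :=
    exists_extension (hA a) (hANR a a.2) h𝒰
  choose 𝒱 h𝒱 hext using hex
  -- The index `none` stands for `𝒰` itself, needed for the simplices realized earlier.
  obtain ⟨𝒱', h𝒱', href⟩ := exists_common_refinement
    (fun o : Option {a : Finset α // a.Nonempty} => o.elim 𝒰 𝒱) (by rintro (_ | a); exacts [h𝒰, h𝒱 a])
  refine ⟨𝒱', h𝒱', href none, fun 𝒲 h𝒲 ι _ L l z g hz hzW hg => ?_⟩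
  let K := sharedLabels L l m
  -- Since `m < card α`, the set `a` is nonempty and `A a` is an algebraic ANR if nonempty. Chains
  -- realized earlier with labels containing `a` lie in `A a` because `A` is decreasing.
  have hext' (a : Finset α) (ha : a.card + m = Fintype.card α) :
      ∃ g' : ∀ q, Finset ι → (SingularSimplex X q →₀ R),
        IsChainRealization (withLabels L l a).faces g' ∧
        (∀ q, ∀ t ∈ (withLabels L l a ⊓ K).faces, t.card = q + 1 → g' q t = g q t) ∧
        (∀ q, ∀ t ∈ (withLabels L l a).faces, t.card = q + 1 → g' q t ∈ chainsIn R (A a) q) ∧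
        ∀ s ∈ (withLabels L l a).faces, ∃ U ∈ 𝒰, ∀ q, ∀ t ∈ (withLabels L l a).faces,
          t.card = q + 1 → t ⊆ s → chainSupport (g' q t) ⊆ U := by
    have hane : a.Nonempty := Finset.card_pos.mp (by omega)
    refine hext ⟨a, hane⟩ ι (withLabels L l a) (withLabels L l a ⊓ K) g inf_le_left
      (fun x hx => ⟨hx, hx.1, Or.inl (Finset.card_singleton x)⟩) (fun t ht => ?_)
      ⟨fun x hx => hg.chain.1 x hx.2, fun q t ht => hg.chain.2 q t ht.2⟩
      (fun q t ht hq => Finsupp.supported_mono (fun σ hσ => hσ.trans (hmono _ _ ht.1.2))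
        (hg.mem q t ht.2 hq)) (fun s hs => ?_)
    · obtain ⟨x, hx⟩ := (L.isRelLowerSet_faces ht.1).1
      have hxL : {x} ∈ L.faces := (L.isRelLowerSet_faces ht.1).2
        (Finset.singleton_subset_iff.mpr hx) (Finset.singleton_nonempty x)
      exact ⟨z x, hmono _ _ (ht.2.trans (Finset.inf_le hx)) (hz x hxL)⟩
    · obtain ⟨V', hV', h⟩ := hg.small_faces h𝒲 (hzW s hs.1)
      obtain ⟨V, hV, hVV'⟩ := href (some ⟨a, hane⟩) V' hV'
      exact ⟨V, hV, fun q t ht hq hts => (h q t ht.2 hq hts).trans hVV'⟩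
  choose G hG1 hG2 hG3 hG4 using hext'
  let g' : ∀ q, Finset ι → (SingularSimplex X q →₀ R) := fun q t =>
    if t ∈ K.faces then g q t else
      if h : (t.inf l).card + m = Fintype.card α then G _ h q t else 0
  have hold {q t} (ht : t ∈ K.faces) : g' q t = g q t := if_pos ht
  have hcard {t} (ht : t ∈ (sharedLabels L l (m + 1)).faces) (htK : t ∉ K.faces) :
      (t.inf l).card + m = Fintype.card α := by
    have h1 := ht.2
    have h2 : ¬ (t.card = 1 ∨ Fintype.card α + 1 ≤ (t.inf l).card + m) := fun h => htK ⟨ht.1, h⟩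
    omega
  -- The gluing: a simplex with labels containing `a` was either realized earlier, where the
  -- extension agrees with `g`, or has exactly the labels `a`, since otherwise it would share more.
  have hnew {q t a} (ha : a.card + m = Fintype.card α) (ht : t ∈ (withLabels L l a).faces)
      (hq : t.card = q + 1) : g' q t = G a ha q t := by
    by_cases htK : t ∈ K.faces
    · rw [hold htK, hG2 a ha q t ⟨ht, htK⟩ hq]
    · have h1 := Finset.card_le_card ht.2
      have h2 : ¬ (t.card = 1 ∨ Fintype.card α + 1 ≤ (t.inf l).card + m) := fun h => htK ⟨ht.1, h⟩
      obtain rfl : a = t.inf l := Finset.eq_of_subset_of_card_le ht.2 (by omega)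
      exact (if_neg htK).trans (dif_pos ha)
  have hself {t} (ht : t ∈ L.faces) : t ∈ (withLabels L l (t.inf l)).faces := ⟨ht, subset_rfl⟩
  have hvert {x} (hx : {x} ∈ L.faces) : {x} ∈ K.faces := ⟨hx, Or.inl (Finset.card_singleton x)⟩
  refine ⟨g', ⟨fun x hx => ?_, fun q t ht hq => ?_⟩, fun q t ht hq => ?_, fun x hx => ?_,
    fun t ht => ?_⟩
  · rw [hold (hvert hx.1)]
    exact hg.chain.1 x (hvert hx.1)
  · by_cases htK : t ∈ K.faces
    · rw [hold htK, hg.chain.2 q t htK hq]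
      exact Finset.sum_congr rfl fun x hx => by rw [hold (K.erase_mem_faces htK hq hx).1]
    · rw [hnew (hcard ht htK) (hself ht.1) hq, hG1 _ (hcard ht htK) |>.2 q t (hself ht.1) hq]
      refine Finset.sum_congr rfl fun x hx => ?_
      have h := (withLabels L l (t.inf l)).erase_mem_faces (hself ht.1) hq hx
      rw [hnew (hcard ht htK) h.1 h.2]
  · by_cases htK : t ∈ K.faces
    · rw [hold htK]
      exact hg.mem q t htK hq
    · rw [hnew (hcard ht htK) (hself ht.1) hq]
      exact hG3 _ _ q t (hself ht.1) hq
  · rw [hold (hvert hx.1)]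
    exact hg.vertex x (hvert hx.1)
  · by_cases htK : t ∈ K.faces
    · obtain ⟨W, hW, hzW, htW⟩ := hg.small t htK
      obtain ⟨V, hV, hstar⟩ := h𝒲 W hW
      obtain ⟨U, hU, hVU⟩ := href none V hV
      obtain ⟨x, hx⟩ := (K.isRelLowerSet_faces htK).1
      have hWU := (hstar W hW ⟨z x, hzW x hx, hzW x hx⟩).trans hVU
      refine ⟨U, hU, fun x hx => hWU (hzW x hx), fun q hq => ?_⟩
      rw [hold htK]
      exact (htW q hq).trans hWU
    · obtain ⟨U, hU, h⟩ := hG4 _ (hcard ht htK) t (hself ht.1)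
      refine ⟨U, hU, fun x hx => ?_, fun q hq => ?_⟩
      -- The extension bounds only supports of chains. The point `z x` is recovered as the support
      -- of the vertex chain, which is where `1 ≠ 0` in `R` enters.
      · have hxt : {x} ⊆ t := Finset.singleton_subset_iff.mpr hx
        have hx' := ((withLabels L l (t.inf l)).isRelLowerSet_faces (hself ht.1)).2 hxt
          (Finset.singleton_nonempty x)
        have := h 0 {x} hx' (Finset.card_singleton x) hxt
        rw [← hnew _ hx' (Finset.card_singleton x), hold (hvert hx'.1),
          hg.vertex x (hvert hx'.1), chainSupport_single] at this
        exact this ⟨stdSimplex.vertex 0, rfl⟩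
      · rw [hnew (hcard ht htK) (hself ht.1) hq]
        exact h q t (hself ht.1) hq subset_rfl

/-- Sufficiently small labelled complexes have small labelled realizations. -/
theorem exists_labelledRealization [TopologicalSpace.MetrizableSpace X] [Nontrivial R]
    {A : Finset α → Set X}
    (hA : ∀ a, IsClosed (A a)) (hmono : ∀ a b, a ⊆ b → A b ⊆ A a)
    (hANR : ∀ a, a.Nonempty → (A a).Nonempty → IsAlgebraicANR R (A a))
    (m : ℕ) (hm : m ≤ Fintype.card α) {𝒰 : Set (Set X)} (h𝒰 : IsOpenCovering 𝒰) :
    ∃ 𝒱 : Set (Set X), IsOpenCovering 𝒱 ∧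
      ∀ (ι : Type u) [LinearOrder ι] (L : PreAbstractSimplicialComplex ι) (l : ι → Finset α)
        (z : ι → X), (∀ x, {x} ∈ L.faces → z x ∈ A (l x)) →
        (∀ t ∈ L.faces, ∃ V ∈ 𝒱, ∀ x ∈ t, z x ∈ V) →
        ∃ g : ∀ q, Finset ι → (SingularSimplex X q →₀ R),
          IsLabelledRealization A 𝒰 (sharedLabels L l m) l z g := by
  induction m generalizing 𝒰 with
  | zero => exact ⟨𝒰, h𝒰, fun ι _ L l z hz hs => isLabelledRealization_vertices hz hs⟩
  | succ m ih =>
    obtain ⟨𝒱₁, h𝒱₁, -, hext⟩ := exists_labelledRealization_succ hA hmono hANR hm h𝒰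
    obtain ⟨𝒱₂, h𝒱₂, hstar⟩ := h𝒱₁.exists_star_refinement
    obtain ⟨𝒱₃, h𝒱₃, hreal⟩ := ih (by omega) h𝒱₂
    obtain ⟨𝒱, h𝒱, href⟩ := exists_common_refinement (fun b : Bool => cond b 𝒱₂ 𝒱₃)
      (by rintro (_ | _); exacts [h𝒱₃, h𝒱₂])
    -- The inductive step wants a realization small for the star refinement `𝒱₂`, and the points `z`
    -- small for `𝒱₂` as well; the induction hypothesis wants them small for `𝒱₃`.
    refine ⟨𝒱, h𝒱, fun ι _ L l z hz hs => ?_⟩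
    have hs' (b : Bool) : ∀ t ∈ L.faces, ∃ V ∈ cond b 𝒱₂ 𝒱₃, ∀ x ∈ t, z x ∈ V := fun t ht => by
      obtain ⟨V, hV, h⟩ := hs t ht
      obtain ⟨V', hV', hVV'⟩ := href b V hV
      exact ⟨V', hV', fun x hx => hVV' (h x hx)⟩
    obtain ⟨g, hg⟩ := hreal ι L l z hz (hs' false)
    exact hext 𝒱₂ hstar ι L l z g hz (hs' true) hg

end Tower

/-! ### From singular chains to oriented chains by iterated cones. -/

section Subdivision

variable {X : Type u} [TopologicalSpace X] (R : Type v) [Ring R]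

theorem finsetCone_mem_supported {ι : Type*} [LinearOrder ι] {S T : Set (Finset ι)} {v : ι}
    (h : ∀ t ∈ S, v ∉ t → insert v t ∈ T) {c : Finset ι →₀ R} (hc : c ∈ Finsupp.supported R R S) :
    finsetCone R v c ∈ Finsupp.supported R R T := by
  rw [finsetCone, Finsupp.linearCombination_apply]
  refine Submodule.sum_mem _ fun t ht => Submodule.smul_mem _ _ ?_
  split_ifs with hv
  · exact Submodule.zero_mem _
  · exact zsmul_mem (Finsupp.single_mem_supported R 1 (h t (hc ht) hv)) _

/-- The iterated cone construction turning singular chains into oriented chains, the apex belonging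
to a singular simplex `σ` being `v p σ`. -/
noncomputable def subdivision {ι : Type*} [LinearOrder ι] (v : ∀ p, SingularSimplex X p → ι) :
    ∀ p, (SingularSimplex X p →₀ R) →ₗ[R] (Finset ι →₀ R)
  | 0 => Finsupp.linearCombination R fun σ => Finsupp.single {v 0 σ} 1
  | p + 1 => Finsupp.linearCombination R fun σ =>
      finsetCone R (v (p + 1) σ) (subdivision v p (singularBoundary R p (Finsupp.single σ 1)))

theorem subdivision_zero_single {ι : Type*} [LinearOrder ι] (v : ∀ p, SingularSimplex X p → ι)
    (σ : SingularSimplex X 0) :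
    subdivision R v 0 (Finsupp.single σ 1) = Finsupp.single {v 0 σ} 1 := by
  simp [subdivision]

theorem subdivision_succ_single {ι : Type*} [LinearOrder ι] (v : ∀ p, SingularSimplex X p → ι)
    (p : ℕ) (σ : SingularSimplex X (p + 1)) :
    subdivision R v (p + 1) (Finsupp.single σ 1) =
      finsetCone R (v (p + 1) σ)
        (subdivision R v p (singularBoundary R p (Finsupp.single σ 1))) := by
  simp [subdivision]

theorem finsetBoundary_subdivision_zero {ι : Type*} [LinearOrder ι]
    (v : ∀ p, SingularSimplex X p → ι) (c : SingularSimplex X 0 →₀ R) :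
    finsetBoundary R (subdivision R v 0 c) = singularAug R X c • Finsupp.single ∅ 1 := by
  suffices h : finsetBoundary R ∘ₗ subdivision R v 0 =
      (singularAug R X).smulRight (Finsupp.single ∅ (1 : R)) from LinearMap.congr_fun h c
  refine Finsupp.lhom_ext' fun σ => LinearMap.ext_ring ?_
  simp [subdivision_zero_single, finsetBoundary_single, singularAug_single, vertexSign, Finset.filter_singleton]

theorem finsetBoundary_subdivision_succ {ι : Type*} [LinearOrder ι]
    (v : ∀ p, SingularSimplex X p → ι) (p : ℕ) (c : SingularSimplex X (p + 1) →₀ R) :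
    finsetBoundary R (subdivision R v (p + 1) c) =
      subdivision R v p (singularBoundary R p c) := by
  suffices h : finsetBoundary R ∘ₗ subdivision R v (p + 1) =
      subdivision R v p ∘ₗ singularBoundary R p from LinearMap.congr_fun h c
  refine Finsupp.lhom_ext' fun σ => LinearMap.ext_ring ?_
  simp only [LinearMap.comp_apply, Finsupp.lsingle_apply, subdivision_succ_single,
    finsetBoundary_finsetCone]
  suffices h : finsetBoundary R
      -- The cone formula leaves the cone over this boundary as error term. It vanishes by the same
      -- identity one degree lower, or in degree zero because boundaries have augmentation zero.
      (subdivision R v p (singularBoundary R p (Finsupp.single σ 1))) = 0 by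
    rw [h, map_zero, sub_zero]
  cases p with
  | zero => rw [finsetBoundary_subdivision_zero, singularAug_singularBoundary, zero_smul]
  | succ p =>
    rw [finsetBoundary_subdivision_succ v p, singularBoundary_singularBoundary, map_zero]

/-- Finite subsets of `X`, regarded as the vertices of simplicial complexes. -/
@[ext]
structure VertexSet (X : Type u) where
  carrier : Finset X

-- Oriented chains need some linear order on the vertices; any one will do.
open Classical in
noncomputable instance (X : Type u) : LinearOrder (VertexSet X) :=
  linearOrderOfSTO WellOrderingRel

theorem VertexSet.finite_subset {X : Type u} (F : Finset X) :
    {t : Finset (VertexSet X) | ∀ s ∈ t, s.carrier ⊆ F}.Finite := by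
  have h : {s : VertexSet X | s.carrier ⊆ F}.Finite := by
    have e : {s : VertexSet X | s.carrier ⊆ F} = VertexSet.carrier ⁻¹' (F.powerset : Set _) := by
      ext s
      simp
    rw [e]
    exact F.powerset.finite_toSet.preimage fun s _ s' _ h => VertexSet.ext h
  refine h.toFinset.powerset.finite_toSet.subset fun t ht => ?_
  simp only [Finset.coe_powerset, Set.mem_preimage, Set.mem_powerset_iff]
  intro s hs
  simpa using ht s hs

/-- The set of the labels of the vertices of a singular simplex. -/
noncomputable def vertexLabels (lab : X → X) (p : ℕ) (σ : SingularSimplex X p) : VertexSet X :=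
  ⟨(Set.finite_range fun j => lab (σ (stdSimplex.vertex j))).toFinset⟩

theorem mem_vertexLabels {lab : X → X} {p : ℕ} {σ : SingularSimplex X p} {x : X} :
    x ∈ (vertexLabels lab p σ).carrier ↔ ∃ j, lab (σ (stdSimplex.vertex j)) = x := by
  simp [vertexLabels]

theorem vertexLabels_comp_subset (lab : X → X) {q p : ℕ} (σ : SingularSimplex X p)
    (f : Fin (q + 1) → Fin (p + 1)) :
    (vertexLabels lab q (σ.comp (simplexMap f))).carrier ⊆ (vertexLabels lab p σ).carrier := by
  intro x hx
  obtain ⟨j, rfl⟩ := mem_vertexLabels.mp hx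
  refine mem_vertexLabels.mpr ⟨f j, ?_⟩
  change _ = lab (σ (stdSimplex.map f (stdSimplex.vertex j)))
  rw [stdSimplex.map_vertex]

/-- The sets of `q` subsets of `F` which have a common element. -/
def simplicesBelow {X : Type u} (F : Finset X) (q : ℕ) : Set (Finset (VertexSet X)) :=
  {t | t.card = q ∧ (∃ x, ∀ s ∈ t, x ∈ s.carrier) ∧ ∀ s ∈ t, s.carrier ⊆ F}

theorem simplicesBelow_mono {X : Type u} {F F' : Finset X} (h : F ⊆ F') (q : ℕ) :
    simplicesBelow F q ⊆ simplicesBelow F' q :=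
  fun _ ht => ⟨ht.1, ht.2.1, fun s hs => (ht.2.2 s hs).trans h⟩

/-- The apex of a simplex contains the apexes of its faces, so a point common to a simplex in the
subdivided boundary also lies in the new apex. Degenerate cones vanish, so the number of vertices is
exactly `p + 1`. -/
theorem subdivision_mem_supported (lab : X → X) (p : ℕ) (σ : SingularSimplex X p) :
    subdivision R (vertexLabels lab) p (Finsupp.single σ 1) ∈
      Finsupp.supported R R (simplicesBelow (vertexLabels lab p σ).carrier (p + 1)) := by
  induction p with
  | zero =>
    rw [subdivision_zero_single]
    refine Finsupp.single_mem_supported R 1 ⟨Finset.card_singleton _, ?_, ?_⟩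
    · exact ⟨_, by simpa using mem_vertexLabels.mpr ⟨0, rfl⟩⟩
    · simp
  | succ p ih =>
    rw [subdivision_succ_single]
    refine finsetCone_mem_supported R (S := simplicesBelow (vertexLabels lab (p + 1) σ).carrier
      (p + 1)) ?_ ?_
    · rintro t ⟨hq, ⟨x, hx⟩, ht⟩ hv
      have hne : t.Nonempty := Finset.card_pos.mp (by omega)
      obtain ⟨s, hs⟩ := hne
      refine ⟨by rw [Finset.card_insert_of_notMem hv, hq], ⟨x, ?_⟩, ?_⟩
      · rintro s' hs'
        obtain rfl | hs' := Finset.mem_insert.mp hs'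
        · exact ht s hs (hx s hs)
        · exact hx s' hs'
      · rintro s' hs'
        obtain rfl | hs' := Finset.mem_insert.mp hs'
        · exact subset_rfl
        · exact ht s' hs'
    · rw [singularBoundary_single, map_sum]
      refine Submodule.sum_mem _ fun i _ => ?_
      rw [map_zsmul]
      exact zsmul_mem (Finsupp.supported_mono
        (simplicesBelow_mono (vertexLabels_comp_subset lab σ _) _) (ih _)) _

/-- Cardinality `q + 2` keeps `∅` out of the boundary, where `g` carries no information; degree zero
is treated through the augmentation. -/
theorem IsChainRealization.linearCombination_boundary {R : Type v} [Ring R] {ι : Type*}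
    [LinearOrder ι] {K : Set (Finset ι)} {g : ∀ q, Finset ι → (SingularSimplex X q →₀ R)}
    (hg : IsChainRealization K g) {q : ℕ} {c : Finset ι →₀ R}
    (hc : c ∈ Finsupp.supported R R {t | t ∈ K ∧ t.card = q + 2}) :
    Finsupp.linearCombination R (g q) (finsetBoundary R c) =
      singularBoundary R q (Finsupp.linearCombination R (g (q + 1)) c) := by
  rw [Finsupp.supported_eq_span_single] at hc
  induction hc using Submodule.span_induction with
  | mem c hc =>
    obtain ⟨t, ⟨ht, hq⟩, rfl⟩ := hc
    simp only [finsetBoundary_single, Finsupp.linearCombination_single, one_smul, map_sum,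
      map_zsmul, hg.2 q t ht hq]
  | zero => simp
  | add a b _ _ ha hb => simp only [map_add, ha, hb]
  | smul r a _ ha => simp only [map_smul, ha]

end Subdivision

/-! ### Finite generation and local finiteness near compact sets. -/

section Finiteness

/-- Over a Noetherian ring submodules of finitely generated modules are finitely generated, and only
the degrees below `B` contribute to the direct sum. -/
theorem gradedFinite_of_le {R : Type v} [Ring R] [IsNoetherianRing R] {M : ℕ → Type w}
    [∀ p, AddCommGroup (M p)] [∀ p, Module R (M p)] {P : ∀ p, Submodule R (M p)}
    (Q : ∀ p, Submodule R (M p)) (hQ : ∀ p, (Q p).FG) (hPQ : ∀ p, P p ≤ Q p) (B : ℕ)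
    (hB : ∀ p, B ≤ p → Q p = ⊥) : GradedFinite P := by
  have hfin (p : ℕ) : Module.Finite R (P p) := by
    have := isNoetherian_of_fg_of_noetherian (Q p) (hQ p)
    have := isNoetherian_of_le (hPQ p)
    infer_instance
  rw [GradedFinite, Module.finite_def]
  have htop : (⊤ : Submodule R (DirectSum ℕ fun p => P p)) =
      ⨆ p ∈ Finset.range B, LinearMap.range (DirectSum.lof R ℕ (fun p => P p) p) := by
    refine (top_unique fun x _ => ?_).symm
    induction x using DirectSum.induction_on with
    | zero => exact Submodule.zero_mem _
    | add x y hx hy => exact Submodule.add_mem _ (hx trivial) (hy trivial)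
    | of p x =>
      by_cases hp : p < B
      · exact Submodule.mem_iSup_of_mem p (Submodule.mem_iSup_of_mem (Finset.mem_range.mpr hp)
          ⟨x, rfl⟩)
      · have hx : x = 0 := Subtype.ext (by simpa [hB p (not_lt.mp hp)] using hPQ p x.2)
        rw [hx, map_zero]
        exact Submodule.zero_mem _
  rw [htop]
  refine Submodule.fg_biSup _ _ fun p _ => ?_
  rw [LinearMap.range_eq_map]
  exact (Module.finite_def.mp (hfin p)).map _

theorem LocallyFinite.exists_nhdsSet_finite {X : Type*} [TopologicalSpace X] {ι : Type*}
    {W : ι → Set X} (hW : LocallyFinite W) {D : Set X} (hD : IsCompact D) :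
    ∃ E ∈ 𝓝ˢ D, {i | (W i ∩ E).Nonempty}.Finite := by
  refine hD.induction_on (p := fun D => ∃ E ∈ 𝓝ˢ D, {i | (W i ∩ E).Nonempty}.Finite)
    ⟨∅, by simp, by simp⟩ (fun s t hst ht => ht.imp fun E h => ⟨nhdsSet_mono hst h.1, h.2⟩) ?_ ?_
  · rintro s t ⟨E, hE, hfE⟩ ⟨E', hE', hfE'⟩
    refine ⟨E ∪ E', union_mem_nhdsSet hE hE', (hfE.union hfE').subset fun i hi => ?_⟩
    rwa [Set.mem_ofPred_eq, Set.inter_union_distrib_left, Set.union_nonempty] at hi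
  · intro x hx
    obtain ⟨E, hE, hf⟩ := hW x
    refine ⟨interior E, mem_nhdsWithin_of_mem_nhds (interior_mem_nhds.mpr hE), interior E,
      isOpen_interior.mem_nhdsSet.mpr subset_rfl, hf.subset fun i hi => ?_⟩
    exact hi.mono (Set.inter_subset_inter_right _ interior_subset)

end Finiteness

/-! ### The composite chain map, its finiteness and its smallness. -/

section Main

variable {X : Type u} [TopologicalSpace X] {R : Type v} [Ring R]

theorem map_mem_of_mem_supported {α M : Type*} [AddCommGroup M] [Module R M] {S : Set α}
    {N : Submodule R M} (f : (α →₀ R) →ₗ[R] M) (h : ∀ a ∈ S, f (Finsupp.single a 1) ∈ N)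
    {c : α →₀ R} (hc : c ∈ Finsupp.supported R R S) : f c ∈ N := by
  have : Finsupp.supported R R S ≤ N.comap f := by
    rw [Finsupp.supported_eq_span_single, Submodule.span_le]
    rintro _ ⟨a, ha, rfl⟩
    exact h a ha
  exact this hc

theorem subdivision_mem_of_mem_smallChains {𝒱 : Set (Set X)} {lab : X → X}
    {K : PreAbstractSimplicialComplex (VertexSet X)}
    (hK : ∀ p (σ : SingularSimplex X p), (∃ V ∈ 𝒱, Set.range σ ⊆ V) →
      simplicesBelow (vertexLabels lab p σ).carrier (p + 1) ⊆ K.faces)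
    {p : ℕ} {c : SingularSimplex X p →₀ R} (hc : c ∈ smallChains R 𝒱 p) :
    subdivision R (vertexLabels lab) p c ∈
      Finsupp.supported R R {t | t ∈ K.faces ∧ t.card = p + 1} :=
  map_mem_of_mem_supported _ (fun σ hσ => Finsupp.supported_mono
    (fun _ ht => And.intro (hK p σ hσ ht) ht.1) (subdivision_mem_supported R lab p σ)) hc

theorem IsChainRealization.map_singularBoundary {𝒱 : Set (Set X)} {lab : X → X}
    {K : PreAbstractSimplicialComplex (VertexSet X)}
    (hK : ∀ p (σ : SingularSimplex X p), (∃ V ∈ 𝒱, Set.range σ ⊆ V) →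
      simplicesBelow (vertexLabels lab p σ).carrier (p + 1) ⊆ K.faces)
    {g : ∀ q, Finset (VertexSet X) → (SingularSimplex X q →₀ R)}
    (hg : IsChainRealization K.faces g) {p : ℕ} {c : SingularSimplex X (p + 1) →₀ R}
    (hc : c ∈ smallChains R 𝒱 (p + 1)) :
    Finsupp.linearCombination R (g p) (subdivision R (vertexLabels lab) p
      (singularBoundary R p c)) = singularBoundary R p (Finsupp.linearCombination R (g (p + 1))
        (subdivision R (vertexLabels lab) (p + 1) c)) := by
  rw [← finsetBoundary_subdivision_succ,
    hg.linearCombination_boundary (subdivision_mem_of_mem_smallChains hK hc)]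

theorem IsChainRealization.aug_subdivision {𝒱 : Set (Set X)} {lab : X → X}
    {K : PreAbstractSimplicialComplex (VertexSet X)}
    (hK : ∀ p (σ : SingularSimplex X p), (∃ V ∈ 𝒱, Set.range σ ⊆ V) →
      simplicesBelow (vertexLabels lab p σ).carrier (p + 1) ⊆ K.faces)
    {g : ∀ q, Finset (VertexSet X) → (SingularSimplex X q →₀ R)}
    (hg : IsChainRealization K.faces g) {c : SingularSimplex X 0 →₀ R}
    (hc : c ∈ smallChains R 𝒱 0) :
    singularAug R X (Finsupp.linearCombination R (g 0)
      (subdivision R (vertexLabels lab) 0 c)) = singularAug R X c := by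
  rw [← sub_eq_zero]
  refine map_mem_of_mem_supported (N := ⊥) (singularAug R X ∘ₗ Finsupp.linearCombination R (g 0) ∘ₗ
    subdivision R (vertexLabels lab) 0 - singularAug R X) (fun σ hσ => ?_) hc
  have hσK : {vertexLabels lab 0 σ} ∈ K.faces := by
    refine hK 0 σ hσ ⟨Finset.card_singleton _, ⟨lab (σ (stdSimplex.vertex 0)), ?_⟩, by simp⟩
    simpa using mem_vertexLabels.mpr ⟨0, rfl⟩
  rw [Submodule.mem_bot, LinearMap.sub_apply, LinearMap.comp_apply, LinearMap.comp_apply,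
    subdivision_zero_single, Finsupp.linearCombination_single, one_smul, singularAug_single,
    hg.1 _ hσK, sub_self]

/-- The composition of the iterated cone construction with a realization. -/
noncomputable def IsChainRealization.subdivisionHom {𝒱 : Set (Set X)} {lab : X → X}
    {K : PreAbstractSimplicialComplex (VertexSet X)}
    (hK : ∀ p (σ : SingularSimplex X p), (∃ V ∈ 𝒱, Set.range σ ⊆ V) →
      simplicesBelow (vertexLabels lab p σ).carrier (p + 1) ⊆ K.faces)
    {g : ∀ q, Finset (VertexSet X) → (SingularSimplex X q →₀ R)}
    (hg : IsChainRealization K.faces g) : (smallComplex R 𝒱).Hom (singularComplex R X) where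
  f p := (Finsupp.linearCombination R (g p) ∘ₗ subdivision R (vertexLabels lab) p) ∘ₗ
    (smallChains R 𝒱 p).subtype
  f_d _ c := hg.map_singularBoundary hK c.2
  aug_f c := hg.aug_subdivision hK c.2

theorem chainSupport_linearCombination_subset {ι : Type*} {q : ℕ}
    {g : Finset ι → (SingularSimplex X q →₀ R)} {S : Set (Finset ι)} {U : Set X}
    (h : ∀ t ∈ S, chainSupport (g t) ⊆ U) {c : Finset ι →₀ R} (hc : c ∈ Finsupp.supported R R S) :
    chainSupport (Finsupp.linearCombination R g c) ⊆ U := by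
  rw [← mem_chainsIn_iff]
  refine map_mem_of_mem_supported _ (fun t ht => ?_) hc
  rw [Finsupp.linearCombination_single, one_smul]
  exact (mem_chainsIn_iff R).mpr (h t ht)

/-- A singular simplex in `E` is subdivided into families of subsets of the finite set `F`. There
are finitely many such families, so their values span the image and their cardinalities bound the
degree. -/
theorem gradedFinite_subdivision [IsNoetherianRing R] {𝒱 : Set (Set X)} {lab : X → X}
    (g : ∀ q, Finset (VertexSet X) → (SingularSimplex X q →₀ R)) {E : Set X} {F : Finset X}
    (hF : ∀ x ∈ E, lab x ∈ F) :
    GradedFinite (R := R) (M := fun p => SingularSimplex X p →₀ R) fun p =>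
      ((chainsIn R E p).comap (smallChains R 𝒱 p).subtype).map
        ((Finsupp.linearCombination R (g p) ∘ₗ subdivision R (vertexLabels lab) p) ∘ₗ
          (smallChains R 𝒱 p).subtype) := by
  have hfin := VertexSet.finite_subset F
  have hsub (p : ℕ) : simplicesBelow F (p + 1) ⊆ {t | ∀ s ∈ t, s.carrier ⊆ F} :=
    fun t ht => ht.2.2
  refine gradedFinite_of_le (fun p => Submodule.span R (g p '' simplicesBelow F (p + 1)))
    (fun p => Submodule.fg_span ((hfin.subset (hsub p)).image _)) (fun p => ?_)
    (hfin.toFinset.sup Finset.card) (fun p hp => ?_)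
  · rintro _ ⟨c, hc, rfl⟩
    refine map_mem_of_mem_supported (Finsupp.linearCombination R (g p) ∘ₗ
      subdivision R (vertexLabels lab) p) (fun σ hσ => ?_) hc
    have hσF : (vertexLabels lab p σ).carrier ⊆ F := fun x hx => by
      obtain ⟨j, rfl⟩ := mem_vertexLabels.mp hx
      exact hF _ (hσ ⟨_, rfl⟩)
    refine map_mem_of_mem_supported (Finsupp.linearCombination R (g p)) (fun t ht => ?_)
      (subdivision_mem_supported R lab p σ)
    rw [Finsupp.linearCombination_single, one_smul]
    exact Submodule.subset_span ⟨t, simplicesBelow_mono hσF _ ht, rfl⟩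
  · have : simplicesBelow F (p + 1) = ∅ := by
      refine Set.eq_empty_of_forall_notMem fun t ht => ?_
      have := Finset.le_sup (f := Finset.card) (hfin.mem_toFinset.mpr (hsub p ht))
      have := ht.1
      omega
    simp [this]

/-- Shrink a neighbourhood of `x` to avoid the finitely many closed `Xs i` not containing `x`. A set
inside `O x` can then be represented by `x`, which lies in every `Xs i` that the set meets. -/
theorem exists_subordinate_points [TopologicalSpace.MetrizableSpace X] {n : ℕ} {Xs : Fin n → Set X}
    (hclosed : ∀ i, IsClosed (Xs i)) {𝒬 : Bool → Set (Set X)} (h𝒬 : ∀ b, IsOpenCovering (𝒬 b)) :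
    ∃ O : X → Set X, (∀ x, IsOpen (O x)) ∧ (∀ x, x ∈ O x) ∧ (∀ x b, ∃ Q ∈ 𝒬 b, O x ⊆ Q) ∧
      ∀ x i y, y ∈ O x → y ∈ Xs i → x ∈ Xs i := by
  choose Q hQ hxQ using fun b x => (h𝒬 b).exists_mem x
  refine ⟨fun x => (⋂ b, Q b x) ∩ ⋂ i : {i // x ∉ Xs i}, (Xs i)ᶜ, fun x => ?_, fun x => ?_,
    fun x b => ⟨Q b x, hQ b x, fun y hy => Set.mem_iInter.mp hy.1 b⟩, fun x i y hy hyi => ?_⟩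
  · exact (isOpen_iInter_of_finite fun b => (h𝒬 b).1 _ (hQ b x)).inter
      (isOpen_iInter_of_finite fun i => (hclosed i).isOpen_compl)
  · exact ⟨Set.mem_iInter.mpr fun b => hxQ b x, Set.mem_iInter.mpr fun i => i.2⟩
  · by_contra hx
    exact Set.mem_iInter.mp hy.2 ⟨i, hx⟩ hyi

/-- The complex of the families of sets of points which have a common element, each set being
contained in a member of `O`. -/
def commonPointComplex (O : X → Set X) : PreAbstractSimplicialComplex (VertexSet X) where
  faces := {t | t.Nonempty ∧ (∃ x, ∀ s ∈ t, x ∈ s.carrier) ∧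
    ∀ s ∈ t, ∃ w, ∀ x ∈ s.carrier, x ∈ O w}
  isRelLowerSet_faces := by
    rintro t ⟨hne, ⟨x, hx⟩, ht⟩
    exact ⟨hne, fun t' htt' hne' => ⟨hne', ⟨x, fun s hs => hx s (htt' hs)⟩,
      fun s hs => ht s (htt' hs)⟩⟩

/-- Disposes of empty `X` and of the zero ring: all chain modules vanish and the zero map serves. -/
theorem exists_small_hom_of_subsingleton [IsNoetherianRing R]
    (h : ∀ p, Subsingleton (SingularSimplex X p →₀ R))
    {𝒰 : Set (Set X)} (h𝒰 : IsOpenCovering 𝒰) :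
    ∃ 𝒱 : Set (Set X), IsOpenCovering 𝒱 ∧
      ∃ φ : (smallComplex R 𝒱).Hom (singularComplex R X),
        (∀ (p : ℕ) (σ : SingularSimplex X p) (hσ : ∃ V ∈ 𝒱, Set.range σ ⊆ V),
          ∃ U ∈ 𝒰, Set.range σ ⊆ U ∧
            ∀ (q : ℕ) (τ : SingularSimplex X q) (hτ : IsFace τ σ),
              chainSupport (R := R) (φ.f q ⟨Finsupp.single τ 1,
                single_mem_smallChains R (hτ.small hσ)⟩) ⊆ U) ∧
        ∀ D : Set X, IsCompact D → ∃ E ∈ 𝓝ˢ D,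
          GradedFinite (R := R) (M := fun p => SingularSimplex X p →₀ R) fun p =>
            ((chainsIn R E p).comap (smallChains R 𝒱 p).subtype).map (φ.f p) := by
  have hz (p : ℕ) (c c' : (singularComplex R X).obj p) : c = c' := (h p).elim c c'
  refine ⟨𝒰, h𝒰, ⟨fun p => 0, fun p c => hz p _ _, fun c => ?_⟩, ?_, fun D _ => ⟨Set.univ,
    Filter.univ_mem, gradedFinite_of_le (fun _ => ⊥) (fun p => Submodule.fg_bot) (fun p c _ =>
      (Submodule.mem_bot R).mpr ((h p).elim _ _)) 0 fun _ _ => rfl⟩⟩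
  · exact congrArg (singularAug R X) (hz 0 _ c.1)
  · rintro p σ ⟨U, hU, hσU⟩
    exact ⟨U, hU, hσU, fun q τ hτ => (mem_chainsIn_iff R).mp (Submodule.zero_mem _)⟩

end Main

theorem mainTheorem3 {R : Type v} [Ring R] [IsNoetherianRing R]
    {X : Type u} [TopologicalSpace X] [TopologicalSpace.MetrizableSpace X]
    (n : ℕ) (Xs : Fin n → Set X) (hclosed : ∀ i, IsClosed (Xs i))
    (hcover : ⋃ i, Xs i = Set.univ)
    (hANR : ∀ s : Finset (Fin n), s.Nonempty → (⋂ i ∈ s, Xs i).Nonempty →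
      IsAlgebraicANR R (⋂ i ∈ s, Xs i : Set X))
    (𝒰 : Set (Set X)) (h𝒰 : IsOpenCovering 𝒰) :
    ∃ 𝒱 : Set (Set X), IsOpenCovering 𝒱 ∧
      ∃ φ : (smallComplex R 𝒱).Hom (singularComplex R X),
        (∀ (p : ℕ) (σ : SingularSimplex X p) (hσ : ∃ V ∈ 𝒱, Set.range σ ⊆ V),
          ∃ U ∈ 𝒰, Set.range σ ⊆ U ∧
            ∀ (q : ℕ) (τ : SingularSimplex X q) (hτ : IsFace τ σ),
              chainSupport (R := R) (φ.f q ⟨Finsupp.single τ 1,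
                single_mem_smallChains R (hτ.small hσ)⟩) ⊆ U) ∧
        ∀ D : Set X, IsCompact D → ∃ E ∈ 𝓝ˢ D,
          GradedFinite (R := R) (M := fun p => SingularSimplex X p →₀ R) fun p =>
            ((chainsIn R E p).comap (smallChains R 𝒱 p).subtype).map (φ.f p) := by
  classical
  rcases isEmpty_or_nonempty X with hX | hX
  · refine exists_small_hom_of_subsingleton (fun p => ?_) h𝒰
    have : IsEmpty (SingularSimplex X p) := ⟨fun σ => hX.elim (σ (stdSimplex.vertex 0))⟩
    infer_instance
  rcases subsingleton_or_nontrivial R with hR | hR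
  · exact exists_small_hom_of_subsingleton (fun p => inferInstance) h𝒰
  -- Two stars are spent: from the singular simplex to the points `z s`, and from these to the
  -- realizing chains.
  obtain ⟨𝒰₁, h𝒰₁, hstar₁⟩ := h𝒰.exists_star_refinement
  obtain ⟨𝒰₂, h𝒰₂, hstar₂⟩ := h𝒰₁.exists_star_refinement
  obtain ⟨𝒲, h𝒲, hreal⟩ := exists_labelledRealization (R := R)
    (A := fun a : Finset (Fin n) => ⋂ i ∈ a, Xs i)
    (fun a => isClosed_biInter fun i _ => hclosed i)
    (fun a b hab => Set.biInter_subset_biInter_left hab) hANR n (by simp) h𝒰₁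
  obtain ⟨𝒲', h𝒲', hstar⟩ := h𝒲.exists_star_refinement
  obtain ⟨O, hO, hxO, hOQ, hOX⟩ := exists_subordinate_points hclosed
    (𝒬 := fun b => cond b 𝒰₂ 𝒲') (by rintro (_ | _); exacts [h𝒲', h𝒰₂])
  have hOcov : IsOpenCovering (Set.range O) :=
    ⟨by rintro _ ⟨x, rfl⟩; exact hO x, Set.eq_univ_of_forall fun x => ⟨O x, ⟨x, rfl⟩, hxO x⟩⟩
  obtain ⟨𝒱, h𝒱, hstarO⟩ := hOcov.exists_star_refinement
  choose B hB hxB using h𝒱.exists_mem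
  have : ParacompactSpace X := by
    let := TopologicalSpace.metrizableSpaceMetric X
    infer_instance
  -- As `W x` lies in `B x`, a point and its label lie in a common member of `𝒱`.
  obtain ⟨W, -, hWcov, hWfin, hWB⟩ := precise_refinement B (fun x => h𝒱.1 _ (hB x))
    (Set.eq_univ_of_forall fun x => Set.mem_iUnion.mpr ⟨x, hxB x⟩)
  choose lab hlab using fun x => Set.mem_iUnion.mp (hWcov ▸ Set.mem_univ x)
  have hcenter (p : ℕ) (σ : SingularSimplex X p) (hσ : ∃ V ∈ 𝒱, Set.range σ ⊆ V) :
      ∃ w, Set.range σ ⊆ O w ∧ ∀ x ∈ (vertexLabels lab p σ).carrier, x ∈ O w := by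
    obtain ⟨V, hV, hσV⟩ := hσ
    obtain ⟨_, ⟨w, rfl⟩, hw⟩ := hstarO V hV
    have hv (j) : σ (stdSimplex.vertex j) ∈ V := hσV ⟨_, rfl⟩
    refine ⟨w, hσV.trans (hw V hV ⟨_, hv 0, hv 0⟩), fun x hx => ?_⟩
    obtain ⟨j, rfl⟩ := mem_vertexLabels.mp hx
    exact hw _ (hB _) ⟨_, hv j, hWB _ (hlab _)⟩ (hxB _)
  let L := commonPointComplex O
  have hL (p : ℕ) (σ : SingularSimplex X p) (hσ : ∃ V ∈ 𝒱, Set.range σ ⊆ V) :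
      simplicesBelow (vertexLabels lab p σ).carrier (p + 1) ⊆ L.faces := by
    obtain ⟨w, -, hw⟩ := hcenter p σ hσ
    exact fun t ht => ⟨Finset.card_pos.mp (by have := ht.1; omega), ht.2.1,
      fun s hs => ⟨w, fun x hx => hw x (ht.2.2 s hs hx)⟩⟩
  have hz (s : VertexSet X) : ∃ w, (∃ w, ∀ x ∈ s.carrier, x ∈ O w) → ∀ x ∈ s.carrier, x ∈ O w := by
    by_cases h : ∃ w, ∀ x ∈ s.carrier, x ∈ O w
    · exact h.imp fun w hw _ => hw
    · exact ⟨Classical.arbitrary X, fun h' => (h h').elim⟩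
  choose z hz using hz
  -- Labels come from the sets met by `s`, not from those containing `z s`: a point common to all
  -- vertices then passes its labels to the whole simplex.
  let l : VertexSet X → Finset (Fin n) := fun s => {i | ∃ x ∈ s.carrier, x ∈ Xs i}
  obtain ⟨g, hg⟩ := hreal (VertexSet X) L l z
    (fun s hs => Set.mem_iInter₂.mpr fun i hi => by
      obtain ⟨x, hx, hxi⟩ := (Finset.mem_filter.mp hi).2
      exact hOX _ i x (hz s (hs.2.2 s (Finset.mem_singleton_self s)) x hx) hxi)
    (fun t ht => by
      obtain ⟨⟨s₀, hs₀⟩, ⟨x, hx⟩, ht⟩ := ht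
      have hxz (s) (hs : s ∈ t) : x ∈ O (z s) := hz s (ht s hs) x (hx s hs)
      obtain ⟨Q, hQ, hOQ₀⟩ := hOQ (z s₀) false
      obtain ⟨V, hV, h⟩ := hstar Q hQ
      refine ⟨V, hV, fun s hs => ?_⟩
      obtain ⟨Q', hQ', hOQ'⟩ := hOQ (z s) false
      exact h Q' hQ' ⟨x, hOQ₀ (hxz s₀ hs₀), hOQ' (hxz s hs)⟩ (hOQ' (hxO _)))
  -- For `m = n` the requirement is one shared label, supplied by any `Xs i` containing the common
  -- point.
  have hshared : sharedLabels L l n = L := by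
    refine le_antisymm (fun t ht => ht.1) fun t ht => ⟨ht, Or.inr ?_⟩
    obtain ⟨-, ⟨x, hx⟩, -⟩ := ht
    obtain ⟨i, hi⟩ := Set.mem_iUnion.mp (hcover ▸ Set.mem_univ x)
    have : {i} ⊆ t.inf l := Finset.le_inf fun s hs => Finset.singleton_subset_iff.mpr
      (Finset.mem_filter.mpr ⟨Finset.mem_univ i, x, hx s hs, hi⟩)
    have := Finset.card_le_card this
    rw [Finset.card_singleton] at this
    rw [Fintype.card_fin]
    omega
  rw [hshared] at hg
  refine ⟨𝒱, h𝒱, hg.chain.subdivisionHom hL, fun p σ hσ => ?_, fun D hD => ?_⟩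
  · obtain ⟨w, hσw, hw⟩ := hcenter p σ hσ
    obtain ⟨U₂, hU₂, hOU₂⟩ := hOQ w true
    obtain ⟨U₁, hU₁, h₁⟩ := hstar₂ U₂ hU₂
    obtain ⟨U, hU, h⟩ := hstar₁ U₁ hU₁
    have hU₂₁ : U₂ ⊆ U₁ := h₁ U₂ hU₂ ⟨w, hOU₂ (hxO w), hOU₂ (hxO w)⟩
    have hwU₁ : w ∈ U₁ := hU₂₁ (hOU₂ (hxO w))
    refine ⟨U, hU, (hσw.trans (hOU₂.trans hU₂₁)).trans (h U₁ hU₁ ⟨w, hwU₁, hwU₁⟩),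
      fun q τ hτ => ?_⟩
    refine chainSupport_linearCombination_subset (fun t ht => ?_)
      (subdivision_mem_supported R lab q τ)
    have htL := hL q τ (hτ.small hσ) ht
    obtain ⟨U', hU', hzU', htU'⟩ := hg.small t htL
    -- `U'` meets `U₁` in `z s`: the common point `x` lies in `U₂` and in the member of `𝒰₂` around
    -- `O (z s)`. Since `U₁` depends only on `w`, the same `U` serves every face of `σ`.
    refine (htU' q ht.1).trans (h U' hU' ?_)
    obtain ⟨s, hs⟩ := htL.1
    obtain ⟨x, hx⟩ := ht.2.1
    have hxw : x ∈ O w := by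
      obtain ⟨f, rfl⟩ := hτ
      exact hw x (vertexLabels_comp_subset lab σ f (ht.2.2 s hs (hx s hs)))
    obtain ⟨Q, hQ, hOQ'⟩ := hOQ (z s) true
    refine ⟨z s, h₁ Q hQ ⟨x, hOU₂ hxw, hOQ' (hz s (htL.2.2 s hs) x (hx s hs))⟩ (hOQ' (hxO _)),
      hzU' s hs⟩
  -- The labels of points of `E` are among the finitely many indices whose `W` meets `E`.
  · obtain ⟨E, hE, hfin⟩ := hWfin.exists_nhdsSet_finite hD
    exact ⟨E, hE, gradedFinite_subdivision (F := hfin.toFinset) g fun x hx =>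
      hfin.mem_toFinset.mpr ⟨x, hlab x, hx⟩⟩
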